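/- Let $R$ be a principal ideal domain with field of fractions $K$. For a finite group $G$ whose order is not divisible by the characteristic of $K$, a \emph{Brauer relation} in $G$ is a formal combination $\Theta=\sum_{H\le G}n_H H$ ($n_H\in\mathbb Z$) of subgroups such that the virtual representation $\sum_H\mathbb Q[G/H]^{n_H}$ is zero. Let $M$ be a finitely generated $R[G]$-module. It is \emph{self-dual} if for some field extension $L/K$ there is an isomorphism of $L[G]$-modules $M\otimes_R L\cong \mathrm{Hom}_R(M,R)\otimes_R L$ (contragredient action on $\mathrm{Hom}_R(M,R)$). Write $\operatorname{tors}$ for $R$-torsion, $\overline{P}=P/\operatorname{tors}(P)$, and for a finitely generated torsion $R$-module $T$ let $\operatorname{cont}(T)=\prod_{\mathfrak p\ne 0}\mathfrak p^{\operatorname{length}_{R_{\mathfrak p}}T_{\mathfrak p}}$, identified with a generator. For a $G$-invariant $R$-bilinear pairing $\langle\cdot,\cdot\rangle:M\times M\to L$ that is non-degenerate modulo torsion (i.e. it induces an isomorphism $L\otimes_R M\to\mathrm{Hom}_R(M,L)$), consider $$\prod_{H\le G}\left(\frac{1}{\operatorname{cont}(\operatorname{tors}(M)^H)^2}\det\left(\frac1{|H|}\langle\cdot,\cdot\rangle\Big|_{\overline{M^H}}\right)\right)^{n_H}\in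 L^\times/(R^\times)^2,$$ the determinants being taken on $R$-bases of $\overline{M^H}$. The \emph{regulator constant} $C_\Theta^R(M)\in K^\times/(R^\times)^2$ of a self-dual $M$ is this class for a $K$-valued pairing. Let $G$ be a finite group with $|G|\neq 0$ in $K$ and let $\Theta=\sum_{H\le G} n_HH$ be a Brauer relation in $G$. Then $C_\Theta^R(M)$ does not depend on the choices: for every field extension $L/K$ and every $L$-valued pairing as above on a finitely generated $R[G]$-module $M$, the displayed class is the image of $C^R_\Theta(M)$ in $L^\times/(R^\times)^2$. Moreover: (i) If $G$ is a subgroup of a finite group $X$ with $|X|\ne0$ in $K$, and $N$ is a finitely generated self-dual $R[X]$-module, then $C^R_{\mathrm{Ind}_G^X\Theta}(N)=C^R_\Theta(\mathrm{Res}^X_GN)$, where $\mathrm{Ind}_G^X\Theta=\sum_H n_HH$ with each $H$ regarded as a subgroup of $X$. (ii) If $Y$ is a subgroup of $G$ and $N$ is a finitely generated self-dual $R[Y]$-module, then $C^R_{\mathrm{Res}^G_Y\Theta}(N)=C^R_\Theta(\mathrm{Ind}_Y^GN)$, where $\mathrm{Res}^G_Y\Theta=\sum_H\sum_{g\in H\backslash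 G/Y}n_H\,(Y\cap g^{-1}Hg)$, for any choice of double coset representatives $g$. (iii) If $G$ is a quotient of a finite group $Z$ with $|Z|\neq0$ in $K$, and $M$ is a finitely generated self-dual $R[G]$-module, then $C^R_{\mathrm{Inf}_G^Z\Theta}(\mathrm{Inf}_G^ZM)=C^R_\Theta(M)$, where $\mathrm{Inf}_G^Z\Theta=\sum_Hn_HH'$ and $H'$ is the inverse image of $H$ in $Z$. (iv) If $S$ is a principal ideal domain containing $R$, with field of fractions $E$, and $M$ is a finitely generated self-dual $R[G]$-module, then $C^S_\Theta(M\otimes_RS)$ is the image of $C^R_\Theta(M)$ under the natural map $K^\times/(R^\times)^2\to E^\times/(S^\times)^2$. -/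

import Mathlib

open scoped TensorProduct

noncomputable section

namespace RegConst

/-! ### Brauer relations -/

section Relations

variable {G : Type*} [Group G]

/-- For a function `m` from subgroups to `ℕ`, the permutation representation
`⨁_H ℚ[G/H]^{m H}` of `G` over `ℚ`. -/
def permRep (m : Subgroup G → ℕ) :
    Representation ℚ G
      (DirectSum (Σ H : Subgroup G, Fin (m H)) fun p => MonoidAlgebra ℚ (G ⧸ p.1)) :=
  Representation.directSum fun p : (Σ H : Subgroup G, Fin (m H)) =>
    Representation.ofMulAction ℚ G (G ⧸ p.1)

/-- `Θ = ∑_H n_H H` is a Brauer relation: the virtual permutation representation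
`∑_H ℚ[G/H]^{n_H}` is zero, that is, its positive part is isomorphic to its negative part. -/
def IsBrauerRelation (Θ : Subgroup G →₀ ℤ) : Prop :=
  Nonempty ((permRep fun H => (Θ H).toNat).Equiv (permRep fun H => (-Θ H).toNat))

/-- Induction of a formal combination of subgroups along an (injective) homomorphism `ι : G → X`:
each `H ≤ G` is regarded as a subgroup of `X`. -/
def indRel {X : Type*} [Group X] (ι : G →* X) (Θ : Subgroup G →₀ ℤ) : Subgroup X →₀ ℤ :=
  Θ.mapDomain fun H => H.map ι

/-- Inflation of a formal combination of subgroups along a (surjective) homomorphism `π : Z → G`: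
each `H ≤ G` is replaced by its inverse image in `Z`. -/
def infRel {Z : Type*} [Group Z] (π : Z →* G) (Θ : Subgroup G →₀ ℤ) : Subgroup Z →₀ ℤ :=
  Θ.mapDomain fun H => H.comap π

/-- Restriction of a formal combination of subgroups to `Y ≤ G`:
`∑_H ∑_{g ∈ H\G/Y} n_H (Y ∩ g⁻¹Hg)`, where `r H` picks a representative of each double coset
`HgY`. -/
def resRel (Y : Subgroup G)
    (r : ∀ H : Subgroup G, DoubleCoset.Quotient (H : Set G) (Y : Set G) → G)
    (Θ : Subgroup G →₀ ℤ) : Subgroup Y →₀ ℤ :=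
  Θ.sum fun H n => ∑ᶠ q : DoubleCoset.Quotient (H : Set G) (Y : Set G),
    Finsupp.single ((H.map (MulAut.conj (r H q)⁻¹).toMonoidHom).subgroupOf Y) n

end Relations

/-! ### The group `Lˣ / (Rˣ)²` -/

section UnitClasses

/-- The image of `(Rˣ)²` in `Lˣ`. -/
def unitSquares (R L : Type*) [CommRing R] [Field L] [Algebra R L] : Subgroup Lˣ :=
  ((Units.map (algebraMap R L).toMonoidHom).comp (powMonoidHom 2)).range

/-- The group `Lˣ / (Rˣ)²`. -/
abbrev UnitClass (R L : Type*) [CommRing R] [Field L] [Algebra R L] : Type _ :=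
  Lˣ ⧸ unitSquares R L

/-- The natural map `Kˣ / (Rˣ)² → Eˣ / (Sˣ)²` for compatible inclusions `R → S` and `K → E`. -/
def unitClassMap (R K S E : Type*) [CommRing R] [Field K] [CommRing S] [Field E]
    [Algebra R K] [Algebra R S] [Algebra S E] [Algebra K E] [Algebra R E]
    [IsScalarTower R K E] [IsScalarTower R S E] : UnitClass R K →* UnitClass S E :=
  QuotientGroup.map (unitSquares R K) (unitSquares S E)
    (Units.map (algebraMap K E).toMonoidHom) (by
      rintro _ ⟨u, rfl⟩
      refine ⟨Units.map (algebraMap R S).toMonoidHom u, ?_⟩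
      ext
      simp [← IsScalarTower.algebraMap_apply])

end UnitClasses

/-! ### Content of a finitely generated torsion module -/

section Content

variable (R : Type*) [CommRing R]

/-- The content of a finitely generated torsion module `T` over a principal ideal domain, as an
ideal: the product over the nonzero primes `p` of `p ^ (length of T_p over R_p)`. -/
def contentIdeal (T : Type*) [AddCommGroup T] [Module R T] : Ideal R :=
  ∏ᶠ p : IsDedekindDomain.HeightOneSpectrum R,
    p.asIdeal ^ (Module.length (Localization.AtPrime p.asIdeal)
      (LocalizedModule p.asIdeal.primeCompl T)).toNat

theorem contentIdeal_ne_bot [IsDomain R] (T : Type*) [AddCommGroup T] [Module R T] :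
    contentIdeal R T ≠ ⊥ := by
  unfold contentIdeal
  refine finprod_induction (fun I : Ideal R => I ≠ ⊥) ?_ ?_ ?_
  · simp
  · intro I J hI hJ h
    rcases Ideal.mul_eq_bot.mp h with h | h
    · exact hI h
    · exact hJ h
  · intro p
    exact pow_ne_zero _ p.ne_bot

variable [IsDomain R] [IsPrincipalIdealRing R]

/-- A generator of the content of `T`. -/
def contentGen (T : Type*) [AddCommGroup T] [Module R T] : R :=
  Submodule.IsPrincipal.generator (contentIdeal R T)

theorem contentGen_ne_zero (T : Type*) [AddCommGroup T] [Module R T] : contentGen R T ≠ 0 :=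
  fun h => contentIdeal_ne_bot R T ((Submodule.IsPrincipal.eq_bot_iff_generator_eq_zero _).mpr h)

/-- The class of the square of the content of `T` in `Lˣ / (Rˣ)²`. -/
def contentSqClass (L : Type*) [Field L] [Algebra R L] [FaithfulSMul R L]
    (T : Type*) [AddCommGroup T] [Module R T] : UnitClass R L :=
  QuotientGroup.mk (Units.mk0 (algebraMap R L (contentGen R T))
    ((map_ne_zero_iff _ (FaithfulSMul.algebraMap_injective R L)).mpr
      (contentGen_ne_zero R T)) ^ 2)

end Content

/-! ### Pairings and self-duality -/

section Pairings

variable (R L : Type*) [CommRing R] [Field L] [Algebra R L]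
variable {M : Type*} [AddCommGroup M] [Module R M]
variable {G : Type*} [Group G]

/-- Extension of scalars of a representation of `G` from `R` to an `R`-algebra `S`. -/
def extendScalars {R : Type*} [CommRing R] (S : Type*) [CommRing S] [Algebra R S]
    {M : Type*} [AddCommGroup M] [Module R M] {G : Type*} [Group G] (ρ : Representation R G M) :
    Representation S G (S ⊗[R] M) where
  toFun g := (ρ g).baseChange S
  map_one' := by rw [map_one]; exact LinearMap.baseChange_id
  map_mul' g h := by rw [map_mul]; exact LinearMap.baseChange_mul _ _

/-- `M` is self-dual over `L`: the `L[G]`-modules `M ⊗ L` and `Hom_R(M, R) ⊗ L` are isomorphic,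
where `Hom_R(M, R)` carries the contragredient action. -/
def IsSelfDual (ρ : Representation R G M) : Prop :=
  Nonempty ((extendScalars L ρ).Equiv (extendScalars L ρ.dual))

variable {R L}

/-- `G`-invariance of an `L`-valued `R`-bilinear pairing on `M`. -/
def IsInvariantPairing (ρ : Representation R G M) (B : M →ₗ[R] M →ₗ[R] L) : Prop :=
  ∀ (g : G) (x y : M), B (ρ g x) (ρ g y) = B x y

/-- Non-degeneracy (modulo torsion) of an `L`-valued `R`-bilinear pairing on `M`: the `L`-linear
map `L ⊗ M → Hom_R(M, L)` defined by the pairing is an isomorphism. Both sides only see the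
quotient of `M` by its torsion. -/
def IsNondegeneratePairing (B : M →ₗ[R] M →ₗ[R] L) : Prop :=
  Function.Bijective (LinearMap.liftBaseChange L B : L ⊗[R] M →ₗ[L] (M →ₗ[R] L))

/-- An `L`-valued pairing on `M` descends to the quotient of `M` by its torsion submodule. -/
def modTorsion [IsDomain R] [FaithfulSMul R L] (B : M →ₗ[R] M →ₗ[R] L) :
    (M ⧸ Submodule.torsion R M) →ₗ[R] (M ⧸ Submodule.torsion R M) →ₗ[R] L :=
  LinearMap.liftQ₂ (Submodule.torsion R M) (Submodule.torsion R M) B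
    (by
      rintro x ⟨a, ha⟩
      rw [LinearMap.mem_ker]
      ext y
      have h : algebraMap R L a * B x y = 0 := by
        rw [← Algebra.smul_def, ← LinearMap.smul_apply, ← map_smul]
        have h2 : (a : R) • x = 0 := ha
        simp [h2]
      have h3 : algebraMap R L a ≠ 0 :=
        (map_ne_zero_iff _ (FaithfulSMul.algebraMap_injective R L)).mpr
          (nonZeroDivisors.coe_ne_zero a)
      simpa using (mul_eq_zero.mp h).resolve_left h3)
    (by
      rintro y ⟨a, ha⟩
      rw [LinearMap.mem_ker]
      ext x
      have h : algebraMap R L a * B x y = 0 := by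
        rw [← Algebra.smul_def, ← map_smul]
        have h2 : (a : R) • y = 0 := ha
        simp [h2]
      have h3 : algebraMap R L a ≠ 0 :=
        (map_ne_zero_iff _ (FaithfulSMul.algebraMap_injective R L)).mpr
          (nonZeroDivisors.coe_ne_zero a)
      simpa using (mul_eq_zero.mp h).resolve_left h3)

open Classical in
/-- The class in `Lˣ / (Rˣ)²` of the determinant `det (B (b i) (b j))` of an `L`-valued pairing `B`
on a free `R`-module `F` of finite rank, for a basis `b` of `F` (a change of basis multiplies the
determinant by the square of a unit of `R`). It is `1` by convention if the determinant is zero. -/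
def detClass {F : Type*} [AddCommGroup F] [Module R F] (B : F →ₗ[R] F →ₗ[R] L) : UnitClass R L :=
  if h : ∃ (n : ℕ) (b : Module.Basis (Fin n) R F), (Matrix.of fun i j => B (b i) (b j)).det ≠ 0
  then QuotientGroup.mk (Units.mk0 _ h.choose_spec.choose_spec)
  else 1

end Pairings

/-! ### Regulator constants -/

section RegulatorConstants

variable {R : Type*} [CommRing R] [IsDomain R] [IsPrincipalIdealRing R]
variable {M : Type*} [AddCommGroup M] [Module R M]
variable {G : Type*} [Group G]

/-- The submodule `M^H` of elements fixed by `H`. -/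
def fixedBy (ρ : Representation R G M) (H : Subgroup G) : Submodule R M :=
  Representation.invariants (ρ.comp H.subtype)

/-- The submodule `(tors M)^H`. -/
def torsionFixedBy (ρ : Representation R G M) (H : Subgroup G) : Submodule R M :=
  Submodule.torsion R M ⊓ fixedBy ρ H

/-- The expression
`∏_H ( cont((tors M)^H)⁻² · det( |H|⁻¹ ⟨ , ⟩ on M^H / torsion ) )^{n_H}` in `Lˣ / (Rˣ)²`
computed with an `L`-valued pairing `B = ⟨ , ⟩` on `M`, for `Θ = ∑_H n_H H`. -/
def regulatorProduct {L : Type*} [Field L] [Algebra R L] [FaithfulSMul R L]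
    (Θ : Subgroup G →₀ ℤ) (ρ : Representation R G M) (B : M →ₗ[R] M →ₗ[R] L) : UnitClass R L :=
  Θ.prod fun H n =>
    ((contentSqClass R L (torsionFixedBy ρ H))⁻¹ *
      detClass (modTorsion
        ((Nat.card H : L)⁻¹ • B.domRestrict₁₂ (fixedBy ρ H) (fixedBy ρ H)))) ^ n

open Classical in
/-- The regulator constant of `M` with respect to `Θ`, in `Kˣ / (Rˣ)²`, computed with a `K`-valued
invariant pairing on `M` that is non-degenerate modulo torsion. It is `1` by convention if there is
no such pairing, that is, if `M` is not self-dual. -/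
def regulatorConstant (K : Type*) [Field K] [Algebra R K] [FaithfulSMul R K]
    (Θ : Subgroup G →₀ ℤ) (ρ : Representation R G M) : UnitClass R K :=
  if h : ∃ B : M →ₗ[R] M →ₗ[R] K, IsInvariantPairing ρ B ∧ IsNondegeneratePairing B
  then regulatorProduct Θ ρ h.choose
  else 1

end RegulatorConstants

end RegConst

end

open RegConst

open scoped TensorProduct

noncomputable section

namespace RegConst

/-! ### Cancellation for semisimple modules -/

section Semisimple

variable {k A : Type*} [Field k] [Ring A] [Algebra k A]

/-! The core is independence of the pairing. Two nondegenerate invariant `L`-valued pairings on `M`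
differ by an endomorphism `A` of `V = L ⊗ M` commuting with `G`: `⟨x, y⟩₂ = ⟨A x, y⟩₁`. As `|H|` is
invertible in `L`, averaging over `H` shows that both stay nondegenerate on `V^H`, and there their
determinants differ by `det (A | V^H)`. So the two regulator products differ by `∏ det (A | V^H) ^
n_H`. By Frobenius reciprocity `∏ᵢ V^{Hᵢ} = Hom_G(⨁ᵢ L[G/Hᵢ], V)`, with `A` acting by
postcomposition. Isomorphic permutation modules therefore give equal determinants, and the product
is `1` (`prod_det_fixedMap_eq`, `regulatorProduct_eq_of_pairings`).

Two changes of field are needed: a relation over `ℚ` must hold over `L`, and a pairing over `L` must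
yield one over `K`. Both follow from one criterion: semisimple modules are isomorphic as soon as
`dim End V + dim End W = dim Hom(V, W) + dim Hom(W, V)` (`nonempty_linearEquiv_of_homDim`). Hom
dimensions between permutation modules count double cosets, whatever the field; Hom dimensions in
general are unchanged by field extension, which gives Noether–Deuring. Self-duality is the existence
of a nondegenerate invariant pairing (`isSelfDual_iff_exists_pairing`), so it descends to `K`.

Each functoriality statement is then a comparison of factors for well-chosen pairings. Induction of
relations uses the same pairing, inflation rescales it by the order of the kernel, and extension of
scalars extends it. For induced modules the pairing is `|Y|⁻¹ ∑ₓ B (f x) (f' x)`, and Mackey's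
decomposition turns the factor at `H` into a product over double cosets (`regTerm_coindPairing`). -/

theorem finite_linearMap_of_isScalarTower (V W : Type*) [AddCommGroup V] [AddCommGroup W]
    [Module k V] [Module k W] [Module A V] [Module A W] [IsScalarTower k A V] [IsScalarTower k A W]
    [Module.Finite k V] [Module.Finite k W] : Module.Finite k (V →ₗ[A] W) :=
  Module.Finite.of_injective
    ({ toFun := fun f => f.restrictScalars k, map_add' := fun _ _ => rfl,
       map_smul' := fun _ _ => rfl } : (V →ₗ[A] W) →ₗ[k] (V →ₗ[k] W))
    (fun f g h => by ext x; exact congrArg (fun φ : V →ₗ[k] W => φ x) h)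

variable (k A) in
/-- The dimension of the space of `A`-linear maps. -/
abbrev homDim (V W : Type*) [AddCommGroup V] [AddCommGroup W]
    [Module k V] [Module k W] [Module A V] [Module A W] [IsScalarTower k A V]
    [IsScalarTower k A W] : ℕ := Module.finrank k (V →ₗ[A] W)

variable {V V' W W' : Type*} [AddCommGroup V] [AddCommGroup W] [AddCommGroup V'] [AddCommGroup W']
  [Module k V] [Module k W] [Module A V] [Module A W] [IsScalarTower k A V] [IsScalarTower k A W]
  [Module k V'] [Module k W'] [Module A V'] [Module A W'] [IsScalarTower k A V']
  [IsScalarTower k A W']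

theorem homDim_congr (e : V ≃ₗ[A] V') (e' : W ≃ₗ[A] W') : homDim k A V W = homDim k A V' W' :=
  LinearEquiv.finrank_eq
    { toFun := fun f => e'.toLinearMap ∘ₗ f ∘ₗ e.symm.toLinearMap
      invFun := fun f => e'.symm.toLinearMap ∘ₗ f ∘ₗ e.toLinearMap
      map_add' := fun f g => by ext; simp
      map_smul' := fun c f => by
        ext x
        exact LinearMap.map_smul_of_tower e'.toLinearMap c (f (e.symm x))
      left_inv := fun f => by ext; simp
      right_inv := fun f => by ext; simp }

variable [Module.Finite k V] [Module.Finite k V'] [Module.Finite k W] [Module.Finite k W']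

theorem homDim_prod_left : homDim k A (V × V') W = homDim k A V W + homDim k A V' W := by
  have := finite_linearMap_of_isScalarTower (k := k) (A := A) V W
  have := finite_linearMap_of_isScalarTower (k := k) (A := A) V' W
  rw [← Module.finrank_prod]
  exact (LinearMap.coprodEquiv k).finrank_eq.symm

theorem homDim_prod_right : homDim k A V (W × W') = homDim k A V W + homDim k A V W' := by
  have := finite_linearMap_of_isScalarTower (k := k) (A := A) V W
  have := finite_linearMap_of_isScalarTower (k := k) (A := A) V W'
  rw [← Module.finrank_prod]
  exact (LinearMap.prodEquiv k).finrank_eq.symm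

/-- By semisimplicity `V ≅ C ⊕ ker f` and `W ≅ C ⊕ D`, where `C ≅ range f`. Expanding the Hom
dimensions bilinearly, every term involving the common summand cancels, so the identity passes to
`ker f` and `D`, of smaller total dimension. -/
theorem exists_cancel_of_linearMap_ne_zero [IsSemisimpleModule A V] [IsSemisimpleModule A W]
    (h : homDim k A V V + homDim k A W W = homDim k A V W + homDim k A W V)
    (f : V →ₗ[A] W) (hf : f ≠ 0) :
    ∃ (P : Submodule A V) (Q : Submodule A W),
      homDim k A P P + homDim k A Q Q = homDim k A P Q + homDim k A Q P ∧
      Module.finrank k P + Module.finrank k Q < Module.finrank k V + Module.finrank k W ∧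
      (Nonempty (P ≃ₗ[A] Q) → Nonempty (V ≃ₗ[A] W)) := by
  obtain ⟨C, hC⟩ := exists_isCompl (LinearMap.ker f)
  obtain ⟨D, hD⟩ := exists_isCompl (LinearMap.range f)
  let e₁ : (C × LinearMap.ker f) ≃ₗ[A] V := Submodule.prodEquivOfIsCompl C _ hC.symm
  let e₂ : C ≃ₗ[A] LinearMap.range f :=
    (Submodule.quotientEquivOfIsCompl _ C hC).symm ≪≫ₗ f.quotKerEquivRange
  let e₃ : (C × D) ≃ₗ[A] W :=
    (e₂.prodCongr (LinearEquiv.refl A D)) ≪≫ₗ Submodule.prodEquivOfIsCompl _ D hD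
  have : ∀ P : Submodule A V, Module.Finite k P := fun P =>
    inferInstanceAs (Module.Finite k (P.restrictScalars k))
  have : ∀ P : Submodule A W, Module.Finite k P := fun P =>
    inferInstanceAs (Module.Finite k (P.restrictScalars k))
  refine ⟨LinearMap.ker f, D, ?_, ?_, ?_⟩
  · rw [← homDim_congr (k := k) e₁ e₁, ← homDim_congr (k := k) e₃ e₃,
      ← homDim_congr (k := k) e₁ e₃, ← homDim_congr (k := k) e₃ e₁] at h
    simp only [homDim_prod_left, homDim_prod_right] at h
    omega
  · have h₁ := (e₁.restrictScalars k).finrank_eq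
    have h₃ := (e₃.restrictScalars k).finrank_eq
    rw [Module.finrank_prod] at h₁ h₃
    have : 0 < Module.finrank k C := by
      have : Nontrivial C := by
        rw [Submodule.nontrivial_iff_ne_bot]
        rintro rfl
        apply hf
        rw [← LinearMap.ker_eq_top]
        simpa using hC.sup_eq_top
      exact Module.finrank_pos
    omega
  · rintro ⟨e⟩
    exact ⟨e₁.symm ≪≫ₗ (LinearEquiv.refl A C).prodCongr e ≪≫ₗ e₃⟩

/-- The hypothesis says that the virtual module `V - W` has norm zero for the form `dim Hom`. Common
summands are cancelled until no nonzero map is left in either direction; then both endomorphism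
spaces vanish, and so do the modules. -/
theorem nonempty_linearEquiv_of_homDim (n : ℕ) :
    ∀ (V W : Type*) [AddCommGroup V] [AddCommGroup W]
      [Module k V] [Module k W] [Module A V] [Module A W] [IsScalarTower k A V]
      [IsScalarTower k A W] [Module.Finite k V] [Module.Finite k W]
      [IsSemisimpleModule A V] [IsSemisimpleModule A W],
      Module.finrank k V + Module.finrank k W = n →
      homDim k A V V + homDim k A W W = homDim k A V W + homDim k A W V →
      Nonempty (V ≃ₗ[A] W) := by
  induction n using Nat.strong_induction_on with
  | _ n ih =>
    intro V W _ _ _ _ _ _ _ _ _ _ _ _ hn h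
    have : ∀ P : Submodule A V, Module.Finite k P := fun P =>
      inferInstanceAs (Module.Finite k (P.restrictScalars k))
    have : ∀ P : Submodule A W, Module.Finite k P := fun P =>
      inferInstanceAs (Module.Finite k (P.restrictScalars k))
    by_cases hf : ∃ f : V →ₗ[A] W, f ≠ 0
    · obtain ⟨f, hf⟩ := hf
      obtain ⟨P, Q, h₁, h₂, h₃⟩ := exists_cancel_of_linearMap_ne_zero h f hf
      exact h₃ (ih _ (hn ▸ h₂) P Q rfl h₁)
    by_cases hg : ∃ g : W →ₗ[A] V, g ≠ 0
    · obtain ⟨g, hg⟩ := hg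
      obtain ⟨P, Q, h₁, h₂, h₃⟩ := exists_cancel_of_linearMap_ne_zero
        (k := k) (by rw [add_comm, h, add_comm]) g hg
      obtain ⟨e⟩ := h₃ ((ih _ (by omega) Q P rfl (by rw [add_comm, h₁, add_comm])).map
        LinearEquiv.symm)
      exact ⟨e.symm⟩
    push Not at hf hg
    have e₁ : homDim k A V W = 0 := by
      have : Subsingleton (V →ₗ[A] W) := ⟨fun a b => by rw [hf a, hf b]⟩
      exact Module.finrank_zero_of_subsingleton
    have e₂ : homDim k A W V = 0 := by
      have : Subsingleton (W →ₗ[A] V) := ⟨fun a b => by rw [hg a, hg b]⟩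
      exact Module.finrank_zero_of_subsingleton
    have key : ∀ (U : Type _) [AddCommGroup U] [Module k U] [Module A U] [IsScalarTower k A U]
        [Module.Finite k U], homDim k A U U = 0 → Subsingleton U := by
      intro U _ _ _ _ _ hU
      have := finite_linearMap_of_isScalarTower (k := k) (A := A) U U
      have := Module.finrank_zero_iff.mp hU
      exact ⟨fun x y => by
        have := Subsingleton.elim (LinearMap.id : U →ₗ[A] U) 0
        simpa using (LinearMap.congr_fun this x).trans (LinearMap.congr_fun this y).symm⟩
    have : Subsingleton V := key V (by omega)
    have : Subsingleton W := by
      have hU : homDim k A W W = 0 := by omega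
      have := finite_linearMap_of_isScalarTower (k := k) (A := A) W W
      have := Module.finrank_zero_iff.mp hU
      exact ⟨fun x y => by
        have := Subsingleton.elim (LinearMap.id : W →ₗ[A] W) 0
        simpa using (LinearMap.congr_fun this x).trans (LinearMap.congr_fun this y).symm⟩
    exact ⟨0⟩

end Semisimple

section RepSemisimple

variable {k : Type*} [Field k] {G : Type*} [Group G] [Finite G]
variable {V W : Type*} [AddCommGroup V] [AddCommGroup W] [Module k V] [Module k W]
  [Module.Finite k V] [Module.Finite k W]

/-- Representations of a finite group of order prime to the characteristic are determined by
the dimensions of their spaces of intertwining maps. -/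
theorem nonempty_equiv_of_finrank_intertwiningMap (hG : (Nat.card G : k) ≠ 0)
    (ρ : Representation k G V) (σ : Representation k G W)
    (h : Module.finrank k (ρ.IntertwiningMap ρ) + Module.finrank k (σ.IntertwiningMap σ) =
      Module.finrank k (ρ.IntertwiningMap σ) + Module.finrank k (σ.IntertwiningMap ρ)) :
    Nonempty (ρ.Equiv σ) := by
  -- Through this instance Maschke's theorem makes both modules semisimple.
  have : NeZero (Nat.card G : k) := ⟨hG⟩
  have : Module.Finite k ρ.asModule := inferInstanceAs (Module.Finite k V)
  have : Module.Finite k σ.asModule := inferInstanceAs (Module.Finite k W)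
  simp only [(Representation.IntertwiningMap.equivLinearMapAsModule _ _).finrank_eq] at h
  obtain ⟨e⟩ := nonempty_linearEquiv_of_homDim (k := k) (A := MonoidAlgebra k G) _
    ρ.asModule σ.asModule rfl h
  exact ⟨((Representation.IntertwiningMap.equivLinearMapAsModule ρ σ).symm
    e.toLinearMap).ofBijective e.bijective⟩

end RepSemisimple

/-! ### Flat base change of invariants and of intertwining maps -/

section BaseChange

variable {R : Type*} [CommRing R] {G : Type*} [Group G]
variable {M N : Type*} [AddCommGroup M] [Module R M] [AddCommGroup N] [Module R N]

/-- Equivalent representations have isomorphic invariants. -/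
def invariantsCongr {ρ : Representation R G M} {σ : Representation R G N} (e : M ≃ₗ[R] N)
    (he : ∀ g x, e (ρ g x) = σ g (e x)) : ρ.invariants ≃ₗ[R] σ.invariants :=
  e.ofSubmodules _ _ (by
    ext y
    constructor
    · rintro ⟨x, hx, rfl⟩ g
      have hx' : ∀ g, ρ g x = x := hx
      exact (he g x).symm.trans (congrArg e (hx' g))
    · intro hy
      have hy' : ∀ g, σ g y = y := hy
      refine ⟨e.symm y, fun g => ?_, by simp⟩
      apply e.injective
      rw [he]
      simpa using hy' g)

variable (S : Type*) [CommRing S] [Algebra R S]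

@[simp]
theorem extendScalars_tmul (ρ : Representation R G M) (g : G) (s : S) (m : M) :
    extendScalars S ρ g (s ⊗ₜ[R] m) = s ⊗ₜ ρ g m := by
  simp [extendScalars]

/-- The map `m ↦ (g m - m)_g`, whose kernel consists of the invariants. -/
def invariantsDefect (ρ : Representation R G M) : M →ₗ[R] G → M :=
  LinearMap.pi fun g => ρ g - LinearMap.id

theorem ker_invariantsDefect (ρ : Representation R G M) :
    LinearMap.ker (invariantsDefect ρ) = ρ.invariants := by
  ext x
  simp [invariantsDefect, funext_iff, sub_eq_zero]

/-- Finiteness of `G` makes `G → M` a finite product, which commutes with the tensor product.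
Invariants thereby become the kernel of a base-changed map, to which flatness applies. -/
theorem invariants_extendScalars_eq_ker [Finite G] (ρ : Representation R G M) :
    (extendScalars S ρ).invariants = LinearMap.ker ((invariantsDefect ρ).baseChange S) := by
  classical
  have := Fintype.ofFinite G
  have key : ∀ z g, TensorProduct.piRight R S S (fun _ : G => M)
      ((invariantsDefect ρ).baseChange S z) g = extendScalars S ρ g z - z := by
    intro z g
    induction z with
    | zero => simp
    | add x y hx hy => simp only [map_add, Pi.add_apply, hx, hy]; abel
    | tmul s m => simp [invariantsDefect, TensorProduct.tmul_sub]
  ext z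
  rw [LinearMap.mem_ker, ← (TensorProduct.piRight R S S (fun _ : G => M)).map_eq_zero_iff,
    funext_iff]
  simp only [key, Representation.mem_invariants, Pi.zero_apply, sub_eq_zero]

variable [Module.Flat R S]

theorem range_baseChange_invariants [Finite G] (ρ : Representation R G M) :
    LinearMap.range (ρ.invariants.subtype.baseChange S) = (extendScalars S ρ).invariants := by
  rw [invariants_extendScalars_eq_ker]
  have h := LinearMap.exact_subtype_ker_map (invariantsDefect ρ)
  rw [ker_invariantsDefect] at h
  have h' := Module.Flat.lTensor_exact S h
  ext z
  exact (h' z).symm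

/-- Invariants commute with flat base change. -/
def invariantsBaseChange [Finite G] (ρ : Representation R G M) :
    S ⊗[R] ρ.invariants ≃ₗ[S] (extendScalars S ρ).invariants :=
  (LinearEquiv.ofInjective (ρ.invariants.subtype.baseChange S)
    (Module.Flat.lTensor_preserves_injective_linearMap _ ρ.invariants.injective_subtype)).trans
    (LinearEquiv.ofEq _ _ (range_baseChange_invariants S ρ))

variable [Module.FinitePresentation R M]

variable (M N) in
/-- Linear maps commute with flat base change. -/
def homBaseChange : S ⊗[R] (M →ₗ[R] N) ≃ₗ[S] (S ⊗[R] M →ₗ[S] S ⊗[R] N) :=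
  (Module.FinitePresentation.isBaseChange_map R M N S).equiv

@[simp]
theorem homBaseChange_tmul (s : S) (f : M →ₗ[R] N) :
    homBaseChange M N S (s ⊗ₜ f) = s • f.baseChange S :=
  (Module.FinitePresentation.isBaseChange_map R M N S).equiv_tmul s f

theorem homBaseChange_linHom (ρ : Representation R G M) (σ : Representation R G N) (g : G)
    (z : S ⊗[R] (M →ₗ[R] N)) :
    homBaseChange M N S (extendScalars S (Representation.linHom ρ σ) g z) =
      Representation.linHom (extendScalars S ρ) (extendScalars S σ) g (homBaseChange M N S z) := by
  induction z with
  | zero => simp only [map_zero]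
  | add x y hx hy => simp only [map_add, hx, hy]
  | tmul s f =>
    rw [extendScalars_tmul, homBaseChange_tmul, homBaseChange_tmul, map_smul]
    congr 1
    simp only [Representation.linHom_apply, LinearMap.baseChange_comp]
    rfl

/-- Intertwining maps are the invariants of `linHom`, and both Hom and invariants commute with flat
base change. The dimension thus comes from a single `R`-module. -/
theorem finrank_intertwiningMap_extendScalars [Finite G] (ρ : Representation R G M)
    (σ : Representation R G N) :
    Module.finrank S ((extendScalars S ρ).IntertwiningMap (extendScalars S σ)) =
      Module.finrank S (S ⊗[R] (Representation.linHom ρ σ).invariants) := by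
  let e₁ := invariantsBaseChange S (Representation.linHom ρ σ)
  let e₂ := invariantsCongr (R := S) (M := S ⊗[R] (M →ₗ[R] N))
    (N := S ⊗[R] M →ₗ[S] S ⊗[R] N) (ρ := extendScalars S (Representation.linHom ρ σ))
    (σ := Representation.linHom (extendScalars S ρ) (extendScalars S σ))
    (homBaseChange M N S) (homBaseChange_linHom S ρ σ)
  let e₃ := Representation.invariantsEquivIntertwiningMap (extendScalars S ρ) (extendScalars S σ)
  rw [e₁.finrank_eq, e₂.finrank_eq, e₃.finrank_eq]

end BaseChange

/-! ### Descent of equivalences along a field extension -/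

section Descent

theorem finrank_intertwiningMap_congr {k G V V' W W' : Type*} [Field k] [Group G] [AddCommGroup V]
    [AddCommGroup V'] [AddCommGroup W] [AddCommGroup W'] [Module k V] [Module k V'] [Module k W]
    [Module k W'] {ρ : Representation k G V} {ρ' : Representation k G V'}
    {σ : Representation k G W} {σ' : Representation k G W'} (e : ρ.Equiv ρ') (f : σ.Equiv σ') :
    Module.finrank k (ρ.IntertwiningMap σ) = Module.finrank k (ρ'.IntertwiningMap σ') :=
  LinearEquiv.finrank_eq
    { toFun := fun φ => (f.toIntertwiningMap.comp φ).comp e.symm.toIntertwiningMap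
      invFun := fun φ => (f.symm.toIntertwiningMap.comp φ).comp e.toIntertwiningMap
      map_add' := fun φ ψ => by ext; simp
      map_smul' := fun c φ => by ext; simp
      left_inv := fun φ => by ext; simp
      right_inv := fun φ => by ext; simp }

variable {R K : Type*} (L : Type*) [CommRing R] [IsDomain R] [IsPrincipalIdealRing R]
    [Field K] [Algebra R K] [FaithfulSMul R K]
    [Field L] [Algebra K L] [Algebra R L] [IsScalarTower R K L] [FaithfulSMul R L]
    {G : Type*} [Group G] [Finite G]
    {M N : Type*} [AddCommGroup M] [Module R M] [AddCommGroup N] [Module R N]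
    [Module.Finite R M] [Module.Finite R N]

theorem finrank_intertwiningMap_tower (ρ : Representation R G M) (σ : Representation R G N) :
    Module.finrank L ((extendScalars L ρ).IntertwiningMap (extendScalars L σ)) =
      Module.finrank K ((extendScalars K ρ).IntertwiningMap (extendScalars K σ)) := by
  have : Module.FinitePresentation R M := Module.finitePresentation_of_finite R M
  rw [finrank_intertwiningMap_extendScalars, finrank_intertwiningMap_extendScalars,
    ← (TensorProduct.AlgebraTensorModule.cancelBaseChange R K L L _).finrank_eq,
    Module.finrank_baseChange]

/-- **Noether–Deuring**: representations of a finite group of order prime to the characteristic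
that become equivalent over a larger field are equivalent. -/
theorem nonempty_equiv_of_extendScalars (hG : (Nat.card G : K) ≠ 0)
    (ρ : Representation R G M) (σ : Representation R G N)
    (h : Nonempty ((extendScalars L ρ).Equiv (extendScalars L σ))) :
    Nonempty ((extendScalars K ρ).Equiv (extendScalars K σ)) := by
  obtain ⟨e⟩ := h
  apply nonempty_equiv_of_finrank_intertwiningMap hG
  -- The four dimensions may be measured over `L`, where the equivalence makes them all equal.
  simp only [← finrank_intertwiningMap_tower (K := K) L]
  rw [finrank_intertwiningMap_congr e e, finrank_intertwiningMap_congr e (.refl _),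
    finrank_intertwiningMap_congr (.refl (extendScalars L σ)) e]

end Descent

/-! ### Permutation representations -/

section Permutation

variable (F : Type*) [Field F] {G : Type*} [Group G]

/-- The permutation representation `⨁ᵢ F[G/Hᵢ]`. -/
abbrev cosetRep {ι : Type*} (H : ι → Subgroup G) :
    Representation F G (DirectSum ι fun i => MonoidAlgebra F (G ⧸ H i)) :=
  Representation.directSum fun i => Representation.ofMulAction F G (G ⧸ H i)

variable {F} {V : Type*} [AddCommGroup V] [Module F V] (σ : Representation F G V)

theorem mem_fixedBy {R M : Type*} [CommRing R] [AddCommGroup M] [Module R M]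
    {ρ : Representation R G M} {H : Subgroup G} {x : M} :
    x ∈ fixedBy ρ H ↔ ∀ h ∈ H, ρ h x = x := by
  simp [fixedBy]

/-- The linear map `F[G/H] → V` sending `gH` to `g v`, for `v` fixed by `H`. -/
def cosetMap (H : Subgroup G) (v : fixedBy σ H) : MonoidAlgebra F (G ⧸ H) →ₗ[F] V :=
  Finsupp.linearCombination F (fun x : G ⧸ H => Quotient.liftOn' x (fun g => σ g v.1) (by
    intro a b hab
    rw [QuotientGroup.leftRel_apply] at hab
    have := mem_fixedBy.mp v.2 _ hab
    have h2 : σ b v.1 = σ a (σ (a⁻¹ * b) v.1) := by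
      rw [← Module.End.mul_apply, ← map_mul]; simp
    exact (h2.trans (by rw [this])).symm)) ∘ₗ (MonoidAlgebra.coeffLinearEquiv F).toLinearMap

@[simp]
theorem cosetMap_single (H : Subgroup G) (v : fixedBy σ H) (g : G) (c : F) :
    cosetMap σ H v (MonoidAlgebra.single (g : G ⧸ H) c) = c • σ g v.1 := by
  simp [cosetMap]

variable {ι : Type*} [DecidableEq ι] (H : ι → Subgroup G)

/-- The canonical generator of the `i`-th summand of `⨁ᵢ F[G/Hᵢ]`. -/
def cosetGen (i : ι) : DirectSum ι fun i => MonoidAlgebra F (G ⧸ H i) :=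
  DirectSum.lof F ι (fun i => MonoidAlgebra F (G ⧸ H i)) i
    (MonoidAlgebra.single ((1 : G) : G ⧸ H i) 1)

theorem cosetRep_cosetGen (i : ι) (g : G) :
    cosetRep F H g (cosetGen H i) = DirectSum.lof F ι (fun i => MonoidAlgebra F (G ⧸ H i)) i
      (MonoidAlgebra.single (g : G ⧸ H i) 1) := by
  simp [cosetRep, cosetGen, DirectSum.lmap_lof]

theorem cosetRep_hom_ext {f f' : (cosetRep F H).IntertwiningMap σ}
    (h : ∀ i, f (cosetGen H i) = f' (cosetGen H i)) : f = f' := by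
  apply Representation.IntertwiningMap.ext
  ext i x
  induction x using QuotientGroup.induction_on with
  | H g =>
    have e := cosetRep_cosetGen (F := F) H i g
    simp only [LinearMap.coe_comp, Function.comp_apply, MonoidAlgebra.lsingle_apply]
    rw [← e]
    exact (Representation.IntertwiningMap.isIntertwining _ _ f g _).trans
      ((congrArg (σ g) (h i)).trans
        (Representation.IntertwiningMap.isIntertwining _ _ f' g _).symm)

/-- Frobenius reciprocity: `Hom_G(⨁ᵢ F[G/Hᵢ], V) = ∏ᵢ V^{Hᵢ}`. -/
def cosetRepHom : (cosetRep F H).IntertwiningMap σ →ₗ[F] ∀ i, fixedBy σ (H i) where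
  toFun f i := ⟨f (cosetGen H i), by
    rw [mem_fixedBy]
    intro h hh
    rw [← Representation.IntertwiningMap.isIntertwining, cosetRep_cosetGen, cosetGen]
    congr 3
    rw [QuotientGroup.eq]
    simpa using hh⟩
  map_add' f f' := rfl
  map_smul' c f := rfl

/-- An intertwining map is determined by the images of the generators, and the image of the `i`-th
one can be any vector fixed by `H i`. -/
theorem cosetRepHom_bijective : Function.Bijective (cosetRepHom σ H) := by
  constructor
  · intro f f' h
    exact cosetRep_hom_ext σ H fun i => congrArg Subtype.val (congrFun h i)
  · intro v
    refine ⟨⟨DirectSum.toModule F ι V fun i => cosetMap σ (H i) (v i), ?_⟩, ?_⟩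
    · intro g
      ext i x
      induction x using QuotientGroup.induction_on with
      | H a => simp [DirectSum.lmap_lof]
    · ext i
      change DirectSum.toModule F ι V (fun i => cosetMap σ (H i) (v i)) (cosetGen H i) = _
      simp [cosetGen]

/-- Block diagonal matrices are block triangular for any linear order on the index type, so one is
borrowed from `Fin`. -/
theorem det_blockDiagonal' {R o : Type*} [CommRing R] [Fintype o] [DecidableEq o] {m : o → Type*}
    [∀ i, Fintype (m i)] [∀ i, DecidableEq (m i)] (M : ∀ i, Matrix (m i) (m i) R) :
    (Matrix.blockDiagonal' M).det = ∏ i, (M i).det := by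
  let lo : LinearOrder o := LinearOrder.lift' (Fintype.equivFin o) (Fintype.equivFin o).injective
  have h : (Matrix.blockDiagonal' M).BlockTriangular Sigma.fst := by
    rintro ⟨i, a⟩ ⟨j, b⟩ hij
    exact Matrix.blockDiagonal'_apply_ne M a b (ne_of_gt hij)
  rw [h.det_fintype]
  refine Finset.prod_congr rfl fun k _ => ?_
  let e : m k ≃ {a : Σ i, m i // a.1 = k} :=
    { toFun := fun x => ⟨⟨k, x⟩, rfl⟩
      invFun := fun y => y.2 ▸ y.1.2
      left_inv := fun x => rfl
      right_inv := by rintro ⟨⟨i, x⟩, rfl⟩; rfl }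
  rw [← Matrix.det_submatrix_equiv_self e]
  congr 1
  ext a b
  exact Matrix.blockDiagonal'_apply_eq M k a b

/-- The product of determinants of a family of endomorphisms is the determinant of the product. -/
theorem det_piMap {ι : Type*} [Fintype ι] {V : ι → Type*} [∀ i, AddCommGroup (V i)]
    [∀ i, Module F (V i)] [∀ i, Module.Finite F (V i)] (f : ∀ i, V i →ₗ[F] V i) :
    (LinearMap.pi fun i => f i ∘ₗ LinearMap.proj i).det = ∏ i, (f i).det := by
  classical
  let b := fun i => Module.Free.chooseBasis F (V i)
  rw [← LinearMap.det_toMatrix (Pi.basis b)]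
  have : LinearMap.toMatrix (Pi.basis b) (Pi.basis b)
      (LinearMap.pi fun i => f i ∘ₗ LinearMap.proj i) =
      Matrix.blockDiagonal' fun i => LinearMap.toMatrix (b i) (b i) (f i) := by
    ext ⟨i, k⟩ ⟨j, l⟩
    rw [LinearMap.toMatrix_apply, Matrix.blockDiagonal'_apply]
    simp only [Pi.basis_apply, Pi.basis_repr]
    split_ifs with h
    · subst h
      simp [LinearMap.toMatrix_apply]
    · simp [Pi.single_eq_of_ne h]
  rw [this, det_blockDiagonal']
  simp

/-! ### Determinants of equivariant endomorphisms on fixed spaces -/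

section Determinants

variable [Module.Finite F V]

/-- The restriction to the fixed space of `H` of an endomorphism commuting with the group. -/
def fixedMap (A : V →ₗ[F] V) (hA : ∀ g x, A (σ g x) = σ g (A x)) (H : Subgroup G) :
    fixedBy σ H →ₗ[F] fixedBy σ H :=
  A.restrict fun x hx => by
    rw [mem_fixedBy] at hx ⊢
    intro h hh
    rw [← hA, hx h hh]

/-- Frobenius reciprocity identifies each product of fixed spaces with a Hom space into `V`, on
which `A` acts by postcomposition. Precomposition with `e` commutes with this action, so the two
endomorphisms are conjugate. -/
theorem prod_det_fixedMap_eq {ι κ : Type*} [Fintype ι] [Fintype κ] [DecidableEq ι] [DecidableEq κ]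
    (H : ι → Subgroup G) (H' : κ → Subgroup G) (e : (cosetRep F H).Equiv (cosetRep F H'))
    (A : V →ₗ[F] V) (hA : ∀ g x, A (σ g x) = σ g (A x)) :
    ∏ i, (fixedMap σ A hA (H i)).det = ∏ j, (fixedMap σ A hA (H' j)).det := by
  let E₁ := LinearEquiv.ofBijective _ (cosetRepHom_bijective σ H)
  let E₂ := LinearEquiv.ofBijective _ (cosetRepHom_bijective σ H')
  let E : (cosetRep F H).IntertwiningMap σ ≃ₗ[F] (cosetRep F H').IntertwiningMap σ :=
    { toFun := fun φ => φ.comp e.symm.toIntertwiningMap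
      invFun := fun φ => φ.comp e.toIntertwiningMap
      map_add' := fun φ ψ => by ext; simp
      map_smul' := fun c φ => by ext; simp
      left_inv := fun φ => by ext; simp
      right_inv := fun φ => by ext; simp }
  let A' : σ.IntertwiningMap σ := ⟨A, fun g => LinearMap.ext fun x => hA g x⟩
  rw [← det_piMap, ← det_piMap]
  let Φ := E₁.symm ≪≫ₗ E ≪≫ₗ E₂
  rw [← LinearMap.det_conj (LinearMap.pi fun i => fixedMap σ A hA (H i) ∘ₗ LinearMap.proj i) Φ]
  congr 1
  have key : ∀ φ : (cosetRep F H).IntertwiningMap σ,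
      (LinearMap.pi fun i => fixedMap σ A hA (H i) ∘ₗ LinearMap.proj i) (E₁ φ) =
        E₁ (A'.comp φ) := fun φ => rfl
  have key' : ∀ φ : (cosetRep F H').IntertwiningMap σ,
      (LinearMap.pi fun i => fixedMap σ A hA (H' i) ∘ₗ LinearMap.proj i) (E₂ φ) =
        E₂ (A'.comp φ) := fun φ => rfl
  apply LinearMap.ext
  intro w
  obtain ⟨φ, rfl⟩ := E₂.surjective w
  rw [key']
  have : Φ.symm (E₂ φ) = E₁ (E.symm φ) := by simp [Φ]
  simp only [LinearMap.comp_apply, LinearEquiv.coe_coe]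
  rw [this, key]
  simp only [Φ, LinearEquiv.trans_apply, LinearEquiv.symm_apply_apply]
  congr 1
  ext x
  simp [E]

end Determinants

end Permutation

/-! ### Brauer relations over an arbitrary field -/

section Brauer

variable (F : Type*) [Field F] {G : Type*} [Group G]

/-- An element of `F[X]` is invariant exactly when its coefficients are constant on orbits. -/
theorem finrank_invariants_ofMulAction (X : Type*) [Finite X] [MulAction G X] :
    Module.finrank F (Representation.ofMulAction F G X).invariants =
      Nat.card (MulAction.orbitRel.Quotient G X) := by
  classical
  have := Fintype.ofFinite (MulAction.orbitRel.Quotient G X)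
  rw [Nat.card_eq_fintype_card, ← Module.finrank_fintype_fun_eq_card F]
  let φ : (MulAction.orbitRel.Quotient G X → F) →ₗ[F]
      (Representation.ofMulAction F G X).invariants :=
    { toFun := fun f => ⟨(MonoidAlgebra.coeffLinearEquiv F).symm
          (Finsupp.equivFunOnFinite.symm fun x => f (Quotient.mk _ x)), fun g => by
        apply (MonoidAlgebra.coeffLinearEquiv F).injective
        ext x
        refine (Representation.coeff_ofMulAction g _ x).trans ?_
        refine congrArg f (Quotient.sound ?_)
        exact ⟨g⁻¹, rfl⟩⟩
      map_add' := fun f f' => by ext; rfl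
      map_smul' := fun c f => by ext; rfl }
  refine (LinearEquiv.ofBijective φ ⟨fun f f' h => ?_, fun v => ?_⟩).finrank_eq.symm
  · funext q
    induction q using Quotient.inductionOn with
    | h x =>
      exact congrArg (fun v : (Representation.ofMulAction F G X).invariants => v.1.coeff x) h
  · have hv : ∀ g, Representation.ofMulAction F G X g v.1 = v.1 := v.2
    refine ⟨fun q => Quotient.liftOn q (fun x => v.1.coeff x) ?_, ?_⟩
    · rintro _ y ⟨g, rfl⟩
      have := Representation.coeff_ofMulAction g v.1 (g • y)
      rw [hv, inv_smul_smul] at this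
      exact this
    · ext x
      rfl

theorem cosetRep_apply {G κ : Type*} [Group G] (H : κ → Subgroup G) (g : G)
    (x : DirectSum κ fun j => MonoidAlgebra F (G ⧸ H j)) (j : κ) :
    cosetRep F H g x j = Representation.ofMulAction F G (G ⧸ H j) g (x j) := by
  simp [cosetRep, DirectSum.lmap_apply]

variable [Finite G]

theorem finrank_fixedBy_cosetRep {κ : Type*} [Fintype κ] (H' : κ → Subgroup G) (K : Subgroup G) :
    Module.finrank F (fixedBy (cosetRep F H') K) =
      ∑ j, Nat.card (MulAction.orbitRel.Quotient K (G ⧸ H' j)) := by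
  classical
  let ρ := fun j => Representation.ofMulAction F K (G ⧸ H' j)
  have e : ∀ j, Module.finrank F (ρ j).invariants =
      Nat.card (MulAction.orbitRel.Quotient K (G ⧸ H' j)) :=
    fun j => finrank_invariants_ofMulAction F _
  simp only [← e]
  rw [← Module.finrank_pi_fintype]
  let φ : fixedBy (cosetRep F H') K →ₗ[F] ∀ j, (ρ j).invariants :=
    LinearMap.pi fun j => (DirectSum.component F κ (fun j => MonoidAlgebra F (G ⧸ H' j)) j).restrict
      fun x hx g => by
        have hx' := mem_fixedBy.mp hx g g.2
        exact (cosetRep_apply F H' g x j).symm.trans (congrArg (fun y => y j) hx')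
  refine (LinearEquiv.ofBijective φ ⟨fun v w h => ?_, fun v => ?_⟩).finrank_eq
  · ext1
    refine DFinsupp.ext fun j => ?_
    exact congrArg Subtype.val (congrFun h j)
  · refine ⟨⟨(DirectSum.linearEquivFunOnFintype F κ fun j => MonoidAlgebra F (G ⧸ H' j)).symm
      fun j => (v j).1, ?_⟩, ?_⟩
    · rw [mem_fixedBy]
      intro g hg
      refine DFinsupp.ext fun j => ?_
      exact (cosetRep_apply F H' g _ j).trans ((v j).2 ⟨g, hg⟩)
    · ext j x
      rfl

/-- After Frobenius reciprocity only orbits of `H i` on `G ⧸ H' j`, that is double cosets, are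
counted. The field `F` does not appear in the answer. -/
theorem finrank_intertwiningMap_cosetRep {ι κ : Type*} [Fintype ι] [Fintype κ]
    (H : ι → Subgroup G) (H' : κ → Subgroup G) :
    Module.finrank F ((cosetRep F H).IntertwiningMap (cosetRep F H')) =
      ∑ i, ∑ j, Nat.card (MulAction.orbitRel.Quotient (H i) (G ⧸ H' j)) := by
  classical
  rw [(LinearEquiv.ofBijective _ (cosetRepHom_bijective (cosetRep F H') H)).finrank_eq,
    Module.finrank_pi_fintype]
  simp only [finrank_fixedBy_cosetRep]

/-- The norm criterion sees only Hom dimensions, and these agree over `k` and `F`. Hence a rational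
relation also holds in positive characteristic prime to `|G|`. -/
theorem nonempty_cosetRep_equiv_of_field (k : Type*) [Field k] (hG : (Nat.card G : F) ≠ 0)
    {ι κ : Type*} [Fintype ι] [Fintype κ]
    (H : ι → Subgroup G) (H' : κ → Subgroup G) (e : (cosetRep k H).Equiv (cosetRep k H')) :
    Nonempty ((cosetRep F H).Equiv (cosetRep F H')) := by
  apply nonempty_equiv_of_finrank_intertwiningMap hG
  simp only [finrank_intertwiningMap_cosetRep]
  simp only [← finrank_intertwiningMap_cosetRep k]
  rw [finrank_intertwiningMap_congr e e, finrank_intertwiningMap_congr e (.refl _),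
    finrank_intertwiningMap_congr (.refl (cosetRep k H')) e]

variable {F} {V : Type*} [AddCommGroup V] [Module F V] [Module.Finite F V]
  (σ : Representation F G V)

/-- The relation, moved from `ℚ` to `F`, equates the products over its positive and negative parts.
Determinants enter as units so that negative exponents make sense in `Fˣ`. -/
theorem prod_det_fixedMap_eq_one (hG : (Nat.card G : F) ≠ 0) (Θ : Subgroup G →₀ ℤ)
    (hΘ : IsBrauerRelation Θ) (A : V →ₗ[F] V) (hA : ∀ g x, A (σ g x) = σ g (A x))
    (u : Subgroup G → Fˣ) (hu : ∀ H, (u H : F) = (fixedMap σ A hA H).det) :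
    Θ.prod (fun H n => u H ^ n) = 1 := by
  classical
  have := Fintype.ofFinite (Subgroup G)
  obtain ⟨e⟩ := hΘ
  obtain ⟨e'⟩ := nonempty_cosetRep_equiv_of_field F ℚ hG
    (fun p : (Σ H : Subgroup G, Fin (Θ H).toNat) => p.1)
    (fun p : (Σ H : Subgroup G, Fin (-Θ H).toNat) => p.1) e
  have h := prod_det_fixedMap_eq σ _ _ e' A hA
  simp only [Fintype.prod_sigma, Finset.prod_const, Finset.card_univ, Fintype.card_fin, ← hu] at h
  have h' : ∏ H, u H ^ (Θ H).toNat = ∏ H, u H ^ (-Θ H).toNat := by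
    ext; simpa using h
  rw [Finsupp.prod_fintype _ _ (by simp)]
  have h2 : ∀ H, u H ^ (Θ H) = u H ^ (Θ H).toNat / u H ^ (-Θ H).toNat := by
    intro H
    rw [← zpow_natCast, ← zpow_natCast, div_eq_mul_inv, ← zpow_sub]
    congr 1
    omega
  simp only [h2, Finset.prod_div_distrib, h', div_self']

end Brauer

/-! ### The content of a torsion module -/

section Content

open IsDedekindDomain

variable {R : Type*} [CommRing R]

theorem length_localizedModule_eq_tensor (P : Ideal R) [P.IsPrime] (T : Type*) [AddCommGroup T]
    [Module R T] :
    Module.length (Localization.AtPrime P) (LocalizedModule P.primeCompl T) =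
      Module.length (Localization.AtPrime P) (Localization.AtPrime P ⊗[R] T) :=
  (LocalizedModule.equivTensorProduct P.primeCompl T).length_eq

theorem length_localizedModule_congr (P : Ideal R) [P.IsPrime] {T T' : Type*} [AddCommGroup T]
    [Module R T] [AddCommGroup T'] [Module R T'] (e : T ≃ₗ[R] T') :
    Module.length (Localization.AtPrime P) (LocalizedModule P.primeCompl T) =
      Module.length (Localization.AtPrime P) (LocalizedModule P.primeCompl T') := by
  rw [length_localizedModule_eq_tensor, length_localizedModule_eq_tensor]
  exact (e.baseChange R (Localization.AtPrime P)).length_eq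

theorem length_localizedModule_pi (P : Ideal R) [P.IsPrime] {ι : Type*} [Fintype ι]
    (T : ι → Type*) [∀ i, AddCommGroup (T i)] [∀ i, Module R (T i)] :
    Module.length (Localization.AtPrime P) (LocalizedModule P.primeCompl (∀ i, T i)) =
      ∑ i, Module.length (Localization.AtPrime P) (LocalizedModule P.primeCompl (T i)) := by
  classical
  simp only [length_localizedModule_eq_tensor]
  rw [(TensorProduct.piRight R (Localization.AtPrime P) (Localization.AtPrime P) T).length_eq,
    Module.length_pi_of_fintype]

theorem length_localizedModule_quotient (P : Ideal R) [P.IsPrime] (a : R) :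
    Module.length (Localization.AtPrime P) (LocalizedModule P.primeCompl (R ⧸ Ideal.span {a})) =
      Ring.ord (Localization.AtPrime P) (algebraMap R _ a) := by
  rw [length_localizedModule_eq_tensor, Ring.ord,
    ← (Algebra.TensorProduct.quotIdealMapEquivTensorQuot (Localization.AtPrime P)
      (Ideal.span {a})).toLinearEquiv.length_eq, Ideal.map_span, Set.image_singleton]

theorem contentIdeal_congr {T T' : Type*} [AddCommGroup T]
    [Module R T] [AddCommGroup T'] [Module R T'] (e : T ≃ₗ[R] T') :
    contentIdeal R T = contentIdeal R T' := by
  unfold contentIdeal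
  simp only [length_localizedModule_congr _ e]

variable [IsDomain R] [IsPrincipalIdealRing R]

/-- In a principal ideal domain `q ∈ p` forces `p = (q)`, so `q` is a uniformizer of the
localization at `p`; otherwise it becomes a unit there. -/
theorem ord_localization_prime (p : HeightOneSpectrum R) {q : R} (hq : Prime q)
    [Decidable (q ∈ p.asIdeal)] :
    Ring.ord (Localization.AtPrime p.asIdeal) (algebraMap R _ q) =
      if q ∈ p.asIdeal then 1 else 0 := by
  have hp := p.isPrime
  have : IsDiscreteValuationRing (Localization.AtPrime p.asIdeal) :=
    IsLocalization.AtPrime.isDiscreteValuationRing_of_dedekind_domain R p.ne_bot _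
  split_ifs with h
  · apply Ring.ord_of_irreducible
    rw [IsDiscreteValuationRing.irreducible_iff_uniformizer,
      ← Localization.AtPrime.map_eq_maximalIdeal]
    have e : p.asIdeal = Ideal.span {q} := by
      have hm : (Ideal.span {q}).IsMaximal :=
        PrincipalIdealRing.isMaximal_of_irreducible hq.irreducible
      exact (hm.eq_of_le hp.ne_top ((Ideal.span_singleton_le_iff_mem _).mpr h)).symm
    exact (congrArg (Ideal.map _) e).trans (by rw [Ideal.map_span, Set.image_singleton])
  · apply Ring.ord_of_isUnit
    exact (IsLocalization.AtPrime.isUnit_to_map_iff _ p.asIdeal q).mpr h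

/-- Induction on the prime factors of `a`: a new factor `q` raises the order by one at `(q)` and
nowhere else. Finiteness of the orders and of the support is carried along, since `ENat.toNat` and
`finprod` are additive, respectively multiplicative, only under such conditions. -/
theorem contentIdeal_cyclic_aux (a : R) (ha : a ≠ 0) :
    (∀ p : HeightOneSpectrum R, Ring.ord (Localization.AtPrime p.asIdeal) (algebraMap R _ a) ≠ ⊤) ∧
    (Function.mulSupport fun p : HeightOneSpectrum R => p.asIdeal ^
      (Ring.ord (Localization.AtPrime p.asIdeal) (algebraMap R _ a)).toNat).Finite ∧
    (∏ᶠ p : HeightOneSpectrum R, p.asIdeal ^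
      (Ring.ord (Localization.AtPrime p.asIdeal) (algebraMap R _ a)).toNat) = Ideal.span {a} := by
  classical
  induction a using UniqueFactorizationMonoid.induction_on_prime with
  | h₁ => exact absurd rfl ha
  | h₂ u hu =>
    have h : ∀ p : HeightOneSpectrum R,
        Ring.ord (Localization.AtPrime p.asIdeal) (algebraMap R _ u) = 0 :=
      fun p => Ring.ord_of_isUnit (hu.map _)
    simp only [h]
    simp only [Ideal.span_singleton_eq_top.mpr hu, ENat.toNat_zero, pow_zero, ← Ideal.one_eq_top]
    refine ⟨fun _ => ENat.zero_ne_top, ?_, finprod_one⟩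
    rw [Function.mulSupport_fun_one]
    exact Set.finite_empty
  | h₃ a q ha' hq ih =>
    obtain ⟨ih₁, ih₂, ih₃⟩ := ih ha'
    have hinj : ∀ p : HeightOneSpectrum R, algebraMap R (Localization.AtPrime p.asIdeal) a ∈
        nonZeroDivisors _ := fun p => by
      rw [mem_nonZeroDivisors_iff_ne_zero]
      exact (map_ne_zero_iff _ (FaithfulSMul.algebraMap_injective R _)).mpr ha'
    have hmul : ∀ p : HeightOneSpectrum R,
        Ring.ord (Localization.AtPrime p.asIdeal) (algebraMap R _ (q * a)) =
          (if q ∈ p.asIdeal then 1 else 0) +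
          Ring.ord (Localization.AtPrime p.asIdeal) (algebraMap R _ a) := fun p => by
      rw [map_mul, Ring.ord_mul _ (hinj p), ord_localization_prime p hq]
    have hfac : ∀ p : HeightOneSpectrum R, p.asIdeal ^
        (Ring.ord (Localization.AtPrime p.asIdeal) (algebraMap R _ (q * a))).toNat =
        (if q ∈ p.asIdeal then p.asIdeal else 1) * p.asIdeal ^
        (Ring.ord (Localization.AtPrime p.asIdeal) (algebraMap R _ a)).toNat := fun p => by
      rw [hmul, ENat.toNat_add (by split_ifs <;> simp) (ih₁ p), pow_add]
      congr 1
      split_ifs <;> simp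
    let P : HeightOneSpectrum R := ⟨Ideal.span {q}, (Ideal.span_singleton_prime hq.ne_zero).mpr hq,
      by simpa using hq.ne_zero⟩
    have hP : ∀ p : HeightOneSpectrum R, q ∈ p.asIdeal → p = P := fun p h => by
      ext1
      have hm : (Ideal.span {q}).IsMaximal :=
        PrincipalIdealRing.isMaximal_of_irreducible hq.irreducible
      exact (hm.eq_of_le p.isPrime.ne_top ((Ideal.span_singleton_le_iff_mem _).mpr h)).symm
    have hfin : (Function.mulSupport fun p : HeightOneSpectrum R =>
        if q ∈ p.asIdeal then p.asIdeal else 1).Finite :=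
      (Set.finite_singleton P).subset fun p h => by
        by_contra hne
        apply h
        exact if_neg fun h' => hne (hP p h')
    refine ⟨fun p => ?_, ?_, ?_⟩
    · rw [hmul]
      have : (if q ∈ p.asIdeal then 1 else 0 : ℕ∞) ≠ ⊤ := by split_ifs <;> simp
      exact WithTop.add_ne_top.mpr ⟨this, ih₁ p⟩
    · simp only [hfac]
      exact (hfin.union ih₂).subset (Function.mulSupport_mul _ _)
    · simp only [hfac]
      rw [finprod_mul_distrib hfin ih₂, ih₃, finprod_eq_single _ P]
      · rw [if_pos (Ideal.mem_span_singleton_self q), Ideal.span_singleton_mul_span_singleton]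
      · exact fun p hne => if_neg fun h' => hne (hP p h')

/-- The content of a direct sum of cyclic torsion modules. -/
theorem contentIdeal_eq_prod {ι : Type*} [Fintype ι] (a : ι → R) (ha : ∀ i, a i ≠ 0) {T : Type*}
    [AddCommGroup T] [Module R T] (e : T ≃ₗ[R] ∀ i, R ⧸ Ideal.span {a i}) :
    contentIdeal R T = ∏ i, Ideal.span {a i} := by
  rw [contentIdeal_congr e, contentIdeal]
  have h : ∀ p : HeightOneSpectrum R, p.asIdeal ^ (Module.length (Localization.AtPrime p.asIdeal)
      (LocalizedModule p.asIdeal.primeCompl (∀ i, R ⧸ Ideal.span {a i}))).toNat =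
      ∏ i, p.asIdeal ^
        (Ring.ord (Localization.AtPrime p.asIdeal) (algebraMap R _ (a i))).toNat := fun p => by
    rw [length_localizedModule_pi, ENat.toNat_sum, Finset.prod_pow_eq_pow_sum]
    · simp only [length_localizedModule_quotient]
    · intro i _
      rw [length_localizedModule_quotient]
      exact (contentIdeal_cyclic_aux _ (ha i)).1 p
  simp only [h]
  rw [finprod_prod_comm _ _ fun i _ => (contentIdeal_cyclic_aux _ (ha i)).2.1]
  exact Finset.prod_congr rfl fun i _ => (contentIdeal_cyclic_aux _ (ha i)).2.2

theorem exists_equiv_pi_cyclic (T : Type*) [AddCommGroup T] [Module R T] [Module.Finite R T]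
    (hT : Module.IsTorsion R T) :
    ∃ (n : ℕ) (a : Fin n → R), (∀ i, a i ≠ 0) ∧
      Nonempty (T ≃ₗ[R] ∀ i, R ⧸ Ideal.span {a i}) := by
  classical
  obtain ⟨ι, _, p, hp, e, ⟨φ⟩⟩ := Module.equiv_directSum_of_isTorsion hT
  refine ⟨Fintype.card ι, fun i =>
    p ((Fintype.equivFin ι).symm i) ^ e ((Fintype.equivFin ι).symm i),
    fun i => pow_ne_zero _ (hp _).ne_zero, ⟨φ ≪≫ₗ DirectSum.linearEquivFunOnFintype R ι _ ≪≫ₗ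
      LinearEquiv.piCongrLeft' R _ (Fintype.equivFin ι)⟩⟩

theorem contentIdeal_pi {κ : Type*} [Fintype κ] (T : κ → Type*) [∀ j, AddCommGroup (T j)]
    [∀ j, Module R (T j)] [∀ j, Module.Finite R (T j)] (hT : ∀ j, Module.IsTorsion R (T j)) :
    contentIdeal R (∀ j, T j) = ∏ j, contentIdeal R (T j) := by
  choose n a ha e using fun j => exists_equiv_pi_cyclic (T j) (hT j)
  rw [contentIdeal_eq_prod (ι := Σ j, Fin (n j)) (fun x => a x.1 x.2) (fun x => ha _ _)
    (LinearEquiv.piCongrRight (fun j => (e j).some) ≪≫ₗ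
      (LinearEquiv.piCurry R fun j i => R ⧸ Ideal.span {a j i}).symm), Fintype.prod_sigma]
  exact Finset.prod_congr rfl fun j _ => (contentIdeal_eq_prod (a j) (ha j) (e j).some).symm

/-- `S ⊗ R/(a)` is `S/(a)`, and the content of a sum of cyclic modules is the product of the ideals
`(a)`. -/
theorem contentIdeal_baseChange (S : Type*) [CommRing S] [IsDomain S] [IsPrincipalIdealRing S]
    [Algebra R S] [FaithfulSMul R S] (T : Type*) [AddCommGroup T] [Module R T]
    [Module.Finite R T] (hT : Module.IsTorsion R T) :
    contentIdeal S (S ⊗[R] T) = (contentIdeal R T).map (algebraMap R S) := by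
  classical
  obtain ⟨n, a, ha, ⟨e⟩⟩ := exists_equiv_pi_cyclic T hT
  have q : ∀ i, S ⊗[R] (R ⧸ Ideal.span {a i}) ≃ₗ[S] S ⧸ Ideal.span {algebraMap R S (a i)} :=
    fun i => (Algebra.TensorProduct.quotIdealMapEquivTensorQuot S
      (Ideal.span {a i})).toLinearEquiv.symm ≪≫ₗ
      Submodule.quotEquivOfEq _ _ (by rw [Ideal.map_span, Set.image_singleton])
  rw [contentIdeal_eq_prod a ha e, contentIdeal_eq_prod (fun i => algebraMap R S (a i))
    (fun i => (map_ne_zero_iff _ (FaithfulSMul.algebraMap_injective R S)).mpr (ha i))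
    (e.baseChange R S ≪≫ₗ TensorProduct.piRight R S S _ ≪≫ₗ LinearEquiv.piCongrRight q),
    ← Ideal.mapHom_apply, map_prod]
  simp [Ideal.map_span]

variable {L : Type*} [Field L] [Algebra R L] [FaithfulSMul R L]

/-- The unit of `L` defined by a nonzero element of `R`. -/
def unitOf (L : Type*) [Field L] [Algebra R L] [FaithfulSMul R L] (a : R) (ha : a ≠ 0) : Lˣ :=
  Units.mk0 (algebraMap R L a) ((map_ne_zero_iff _ (FaithfulSMul.algebraMap_injective R L)).mpr ha)

/-- Two generators differ by a unit of `R`, and its square is trivial in the class group; so any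
generator computes the class. -/
theorem contentSqClass_eq {T : Type*} [AddCommGroup T] [Module R T] {a : R} (ha : a ≠ 0)
    (h : contentIdeal R T = Ideal.span {a}) :
    contentSqClass R L T = QuotientGroup.mk (unitOf L a ha ^ 2) := by
  have h' : Associated (contentGen R T) a := by
    rw [← Ideal.span_singleton_eq_span_singleton, ← h]
    exact Ideal.span_singleton_generator _
  obtain ⟨u, hu⟩ := h'
  refine QuotientGroup.eq.mpr ⟨u, ?_⟩
  ext
  subst hu
  have := (map_ne_zero_iff _ (FaithfulSMul.algebraMap_injective R L)).mpr (contentGen_ne_zero R T)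
  simp [unitOf]
  field_simp

theorem contentSqClass_congr {T T' : Type*} [AddCommGroup T]
    [Module R T] [AddCommGroup T'] [Module R T'] (e : T ≃ₗ[R] T') :
    contentSqClass R L T = contentSqClass R L T' := by
  rw [contentSqClass_eq (contentGen_ne_zero R T') (T := T)]
  · rfl
  · rw [contentIdeal_congr e]
    exact (Ideal.span_singleton_generator _).symm

theorem contentSqClass_pi {κ : Type*} [Fintype κ] (T : κ → Type*) [∀ j, AddCommGroup (T j)]
    [∀ j, Module R (T j)] [∀ j, Module.Finite R (T j)] (hT : ∀ j, Module.IsTorsion R (T j)) :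
    contentSqClass R L (∀ j, T j) = ∏ j, contentSqClass R L (T j) := by
  rw [contentSqClass_eq (a := ∏ j, contentGen R (T j))
    (Finset.prod_ne_zero_iff.mpr fun j _ => contentGen_ne_zero R (T j))]
  · simp only [contentSqClass]
    rw [← QuotientGroup.coe_mk', ← map_prod]
    congr 1
    ext
    simp [unitOf, Finset.prod_pow]
  · rw [contentIdeal_pi T hT, ← Ideal.prod_span_singleton]
    exact Finset.prod_congr rfl fun j _ => (Ideal.span_singleton_generator _).symm

end Content

/-! ### Coordinates modulo torsion -/

theorem mem_torsion_pi {R κ : Type*} [CommRing R] [Fintype κ] {F : κ → Type*}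
    [∀ j, AddCommGroup (F j)]
    [∀ j, Module R (F j)] (x : ∀ j, F j) :
    x ∈ Submodule.torsion R (∀ j, F j) ↔ ∀ j, x j ∈ Submodule.torsion R (F j) := by
  classical
  constructor
  · rintro ⟨a, ha⟩ j
    exact ⟨a, congrFun ha j⟩
  · intro hx
    choose a ha using hx
    refine ⟨∏ j, a j, ?_⟩
    ext j
    rw [Pi.smul_apply, ← Finset.prod_erase_mul _ _ (Finset.mem_univ j), mul_smul]
    simp [ha j]

/-- A coordinate system on `F` modulo torsion: coordinates `F → R^ι` with kernel the torsion
submodule, together with elements `gen i` lifting the standard basis. -/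
structure TorsionCoord (R F ι : Type*) [CommRing R] [AddCommGroup F] [Module R F]
    [DecidableEq ι] where
  /-- the coordinate map -/
  coord : F →ₗ[R] ι → R
  /-- lifts of the standard basis -/
  gen : ι → F
  coord_gen : ∀ i, coord (gen i) = Pi.single i 1
  ker_coord : LinearMap.ker coord = Submodule.torsion R F

namespace TorsionCoord

variable {R F F' ι : Type*} [CommRing R] [AddCommGroup F] [Module R F] [AddCommGroup F']
  [Module R F'] [DecidableEq ι]

/-- A finitely generated module modulo torsion is free over a principal ideal domain. Keeping lifts
of the basis allows Gram matrices to be computed in `F` itself and transported along isomorphisms,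
products and base change. -/
theorem exists_fin [IsDomain R] [IsPrincipalIdealRing R] [Module.Finite R F] :
    ∃ n : ℕ, Nonempty (TorsionCoord R F (Fin n)) := by
  let b := Module.finBasis R (F ⧸ Submodule.torsion R F)
  choose g hg using fun i => (Submodule.torsion R F).mkQ_surjective (b i)
  refine ⟨_, ⟨⟨b.equivFun.toLinearMap ∘ₗ (Submodule.torsion R F).mkQ, g, fun i => ?_, ?_⟩⟩⟩
  · rw [LinearMap.comp_apply, hg]
    simp [Finsupp.single_eq_pi_single]
  · rw [LinearEquiv.ker_comp, Submodule.ker_mkQ]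

/-- Transport along a linear equivalence. -/
def map (c : TorsionCoord R F ι) (e : F ≃ₗ[R] F') : TorsionCoord R F' ι where
  coord := c.coord ∘ₗ e.symm.toLinearMap
  gen i := e (c.gen i)
  coord_gen i := by simp [c.coord_gen]
  ker_coord := by
    ext x
    have h := SetLike.ext_iff.mp c.ker_coord (e.symm x)
    simp only [LinearMap.mem_ker, Submodule.mem_torsion_iff] at h
    simp only [LinearMap.mem_ker, LinearMap.comp_apply, LinearEquiv.coe_coe, h,
      Submodule.mem_torsion_iff]
    exact exists_congr fun a => by
      rw [Submonoid.smul_def, Submonoid.smul_def, ← map_smul, LinearEquiv.map_eq_zero_iff]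

variable [Fintype ι]

theorem coord_surjective (c : TorsionCoord R F ι) : Function.Surjective c.coord := fun v =>
  ⟨∑ i, v i • c.gen i, by
    ext j
    simp [c.coord_gen, Pi.single_apply]⟩

theorem sub_sum_mem_torsion (c : TorsionCoord R F ι) (x : F) :
    x - ∑ i, c.coord x i • c.gen i ∈ Submodule.torsion R F := by
  rw [← c.ker_coord, LinearMap.mem_ker, map_sub, sub_eq_zero]
  ext j
  simp [c.coord_gen, Pi.single_apply]

/-- The basis of `F / tors` defined by coordinates modulo torsion. -/
def quotBasis (c : TorsionCoord R F ι) : Module.Basis ι R (F ⧸ Submodule.torsion R F) :=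
  Module.Basis.ofEquivFun ((Submodule.quotEquivOfEq _ _ c.ker_coord.symm) ≪≫ₗ
    c.coord.quotKerEquivOfSurjective c.coord_surjective)

theorem quotBasis_apply (c : TorsionCoord R F ι) (i : ι) :
    c.quotBasis i = Submodule.Quotient.mk (c.gen i) := by
  rw [quotBasis, Module.Basis.coe_ofEquivFun, LinearEquiv.symm_apply_eq, ← c.coord_gen]
  rfl

variable {κ : Type*} [Fintype κ] [DecidableEq κ] {ν : κ → Type*} [∀ j, DecidableEq (ν j)]

/-- Coordinates on a finite product. -/
def pi [IsDomain R] {F : κ → Type*} [∀ j, AddCommGroup (F j)] [∀ j, Module R (F j)]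
    (c : ∀ j, TorsionCoord R (F j) (ν j)) : TorsionCoord R (∀ j, F j) (Σ j, ν j) where
  coord := LinearMap.pi fun x => LinearMap.proj x.2 ∘ₗ (c x.1).coord ∘ₗ LinearMap.proj x.1
  gen x := Pi.single x.1 ((c x.1).gen x.2)
  coord_gen := by
    rintro ⟨j, i⟩
    ext ⟨j', i'⟩
    simp only [LinearMap.pi_apply, LinearMap.comp_apply, LinearMap.proj_apply]
    by_cases h : j = j'
    · subst h
      simp [(c j).coord_gen, Pi.single_apply]
    · rw [Pi.single_eq_of_ne (Ne.symm h), Pi.single_eq_of_ne (by rintro ⟨⟩; exact h rfl)]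
      simp
  ker_coord := by
    ext x
    have h : ∀ j, (c j).coord (x j) = 0 ↔ x j ∈ Submodule.torsion R (F j) := fun j => by
      rw [← (c j).ker_coord, LinearMap.mem_ker]
    have h₁ : LinearMap.pi (fun x : Σ j, ν j => LinearMap.proj x.2 ∘ₗ (c x.1).coord ∘ₗ
        LinearMap.proj x.1) x = 0 ↔ ∀ j, x j ∈ Submodule.torsion R (F j) := by
      simp only [← h, funext_iff]
      exact ⟨fun h j i => h ⟨j, i⟩, fun h i => h i.1 i.2⟩
    rw [LinearMap.mem_ker, h₁, mem_torsion_pi]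

section BaseChange

variable (S : Type*) [CommRing S] [IsDomain S] [Algebra R S] [IsDomain R] [FaithfulSMul R S]

theorem baseChange_mem_torsion {x : F} (hx : x ∈ Submodule.torsion R F) (s : S) :
    s ⊗ₜ[R] x ∈ Submodule.torsion S (S ⊗[R] F) := by
  obtain ⟨a, ha⟩ := hx
  refine ⟨⟨algebraMap R S a, mem_nonZeroDivisors_of_ne_zero
    ((map_ne_zero_iff _ (FaithfulSMul.algebraMap_injective R S)).mpr
      (nonZeroDivisors.coe_ne_zero a))⟩, ?_⟩
  have ha' : (a : R) • x = 0 := ha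
  rw [Submonoid.mk_smul, algebraMap_smul, ← TensorProduct.tmul_smul, ha', TensorProduct.tmul_zero]

/-- Coordinates modulo torsion are compatible with extension of scalars. -/
def baseChange (c : TorsionCoord R F ι) : TorsionCoord S (S ⊗[R] F) ι where
  coord := (TensorProduct.piScalarRight R S S ι).toLinearMap ∘ₗ c.coord.baseChange S
  gen i := 1 ⊗ₜ c.gen i
  coord_gen i := by
    ext j
    simp [c.coord_gen, Pi.single_apply]
  ker_coord := by
    apply le_antisymm
    · rw [LinearEquiv.ker_comp]
      have h := LinearMap.exact_subtype_ker_map c.coord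
      -- Right exactness is enough: the kernel of the extended coordinates is spanned by tensors `s
      -- ⊗ x` with `x` torsion.
      have h' := lTensor_exact S h c.coord_surjective
      intro z hz
      obtain ⟨w, rfl⟩ := (h' z).mp hz
      clear hz
      induction w with
      | zero => simp
      | add x y hx hy =>
        rw [map_add]
        exact add_mem hx hy
      | tmul s x =>
        exact baseChange_mem_torsion S (c.ker_coord ▸ x.2) s
    · rintro z ⟨a, ha⟩
      rw [LinearMap.mem_ker]
      have ha' : (a : S) • z = 0 := ha
      have := congrArg ((TensorProduct.piScalarRight R S S ι).toLinearMap ∘ₗ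
        c.coord.baseChange S) ha'
      rw [map_smul, map_zero] at this
      exact (smul_eq_zero.mp this).resolve_left (nonZeroDivisors.coe_ne_zero a)

end BaseChange

section Field

variable {L : Type*} [Field L] {V : Type*} [AddCommGroup V] [Module L V]

theorem torsion_field_eq_bot : Submodule.torsion L V = ⊥ :=
  Submodule.isTorsionFree_iff_torsion_eq_bot.mp inferInstance

/-- Over a field, coordinates modulo torsion are the same as a basis. -/
def basis (c : TorsionCoord L V ι) : Module.Basis ι L V :=
  Module.Basis.ofEquivFun (LinearEquiv.ofBijective c.coord
    ⟨LinearMap.ker_eq_bot.mp (c.ker_coord.trans torsion_field_eq_bot), c.coord_surjective⟩)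

@[simp]
theorem basis_apply (c : TorsionCoord L V ι) (i : ι) : c.basis i = c.gen i := by
  rw [basis, Module.Basis.coe_ofEquivFun, LinearEquiv.symm_apply_eq, ← c.coord_gen]
  rfl

end Field

section Gram

variable {L : Type*} [Field L] [Algebra R L]

/-- The Gram matrix of a pairing modulo torsion. -/
def gram (c : TorsionCoord R F ι) (B : F →ₗ[R] F →ₗ[R] L) : Matrix ι ι L :=
  Matrix.of fun i j => B (c.gen i) (c.gen j)

end Gram

end TorsionCoord

/-! ### Classes of determinants -/

section DetClass

variable {R L F ι : Type*} [CommRing R] [Field L] [Algebra R L]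
  [AddCommGroup F] [Module R F] [Fintype ι] [DecidableEq ι]

theorem det_gram_change_basis (B : F →ₗ[R] F →ₗ[R] L) (b b' : Module.Basis ι R F) :
    (Matrix.of fun i j => B (b' i) (b' j)).det =
      algebraMap R L (b.det b') ^ 2 * (Matrix.of fun i j => B (b i) (b j)).det := by
  have h : (Matrix.of fun i j => B (b' i) (b' j)) =
      ((b.toMatrix b').map (algebraMap R L)).transpose * (Matrix.of fun i j => B (b i) (b j)) *
        (b.toMatrix b').map (algebraMap R L) := by
    ext i j
    simp only [Matrix.of_apply, Matrix.mul_apply, Matrix.transpose_apply, Matrix.map_apply]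
    conv_lhs => rw [← b.sum_toMatrix_smul_self b' i, ← b.sum_toMatrix_smul_self b' j]
    simp only [map_sum, map_smul, LinearMap.sum_apply, LinearMap.smul_apply, Finset.sum_mul,
      Algebra.smul_def, Finset.mul_sum]
    refine Finset.sum_congr rfl fun k _ => Finset.sum_congr rfl fun l _ => by ring
  rw [h, Matrix.det_mul, Matrix.det_mul, Matrix.det_transpose, Module.Basis.det_apply,
    RingHom.map_det, RingHom.mapMatrix_apply]
  ring

/-- A change of basis multiplies the determinant by the square of a unit of `R`, so the basis chosen
in the definition may be replaced by any other. -/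
theorem detClass_eq [Nontrivial R] (B : F →ₗ[R] F →ₗ[R] L) (b : Module.Basis ι R F)
    (h : (Matrix.of fun i j => B (b i) (b j)).det ≠ 0) :
    detClass B = QuotientGroup.mk (Units.mk0 _ h) := by
  have hex : ∃ (n : ℕ) (b : Module.Basis (Fin n) R F),
      (Matrix.of fun i j => B (b i) (b j)).det ≠ 0 := by
    refine ⟨_, b.reindex (Fintype.equivFin ι), ?_⟩
    convert h using 1
    rw [← Matrix.det_submatrix_equiv_self (Fintype.equivFin ι).symm]
    congr 1
    ext i j
    simp
  rw [detClass, dif_pos hex]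
  set n := hex.choose
  set b₁ := hex.choose_spec.choose
  have h₁ := hex.choose_spec.choose_spec
  -- The chosen basis comes with its own `n`; the invariant basis number property matches it with
  -- `ι`.
  let e : Fin n ≃ ι := b₁.indexEquiv b
  have hr : (Matrix.of fun i j => B (b₁ i) (b₁ j)).det =
      (Matrix.of fun i j => B (b₁.reindex e i) (b₁.reindex e j)).det := by
    rw [← Matrix.det_submatrix_equiv_self e.symm]
    congr 1
    ext i j
    simp
  rw [eq_comm, QuotientGroup.eq]
  obtain ⟨u, hu⟩ := b.isUnit_det (b₁.reindex e)
  refine ⟨u, ?_⟩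
  ext
  simp only [Units.val_mul, Units.val_inv_eq_inv_val, Units.val_mk0]
  rw [hr, det_gram_change_basis B b (b₁.reindex e), ← hu]
  field_simp
  simp

variable [IsDomain R] [FaithfulSMul R L]

theorem detClass_modTorsion_eq (B : F →ₗ[R] F →ₗ[R] L) (c : TorsionCoord R F ι)
    (h : (c.gram B).det ≠ 0) :
    detClass (modTorsion B) = QuotientGroup.mk (Units.mk0 _ h) := by
  have e : (Matrix.of fun i j => modTorsion B (c.quotBasis i) (c.quotBasis j)) = c.gram B := by
    ext i j
    simp [TorsionCoord.quotBasis_apply, TorsionCoord.gram, modTorsion]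
  rw [detClass_eq (modTorsion B) c.quotBasis (by rwa [e])]
  congr 2
  exact congrArg _ e

end DetClass

/-! ### Extension of pairings, nondegeneracy -/

section Pairings

variable {R L M : Type*} [CommRing R] [Field L] [Algebra R L] [AddCommGroup M] [Module R M]

/-- Extension of scalars of a pairing. -/
def extendPairing (S : Type*) [CommRing S] [Algebra R S] [Algebra S L] [IsScalarTower R S L]
    (B : M →ₗ[R] M →ₗ[R] L) : S ⊗[R] M →ₗ[S] S ⊗[R] M →ₗ[S] L :=
  LinearMap.liftBaseChange S
    (((LinearMap.liftBaseChangeEquiv S).toLinearMap.restrictScalars R) ∘ₗ B)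

@[simp]
theorem extendPairing_tmul (S : Type*) [CommRing S] [Algebra R S] [Algebra S L]
    [IsScalarTower R S L] (B : M →ₗ[R] M →ₗ[R] L) (s t : S) (x y : M) :
    extendPairing S B (s ⊗ₜ x) (t ⊗ₜ y) = algebraMap S L s * (algebraMap S L t * B x y) := by
  simp [extendPairing, Algebra.smul_def]

/-- A pairing with values in `K` as a pairing with values in an extension of `K`. -/
def mapPairing {K : Type*} [Field K] [Algebra R K] (L : Type*) [Field L] [Algebra R L]
    [Algebra K L] [IsScalarTower R K L] (B : M →ₗ[R] M →ₗ[R] K) : M →ₗ[R] M →ₗ[R] L :=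
  B.compr₂ (IsScalarTower.toAlgHom R K L).toLinearMap

@[simp]
theorem mapPairing_apply {K : Type*} [Field K] [Algebra R K] (L : Type*) [Field L] [Algebra R L]
    [Algebra K L] [IsScalarTower R K L] (B : M →ₗ[R] M →ₗ[R] K) (x y : M) :
    mapPairing L B x y = algebraMap K L (B x y) := by
  simp [mapPairing]

variable {ι : Type*} [DecidableEq ι] (c : TorsionCoord R M ι)

theorem gram_mapPairing {K : Type*} [Field K] [Algebra R K] [Algebra K L] [IsScalarTower R K L]
    (B : M →ₗ[R] M →ₗ[R] K) : c.gram (mapPairing L B) = (c.gram B).map (algebraMap K L) := by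
  ext i j
  simp [TorsionCoord.gram]

variable [Fintype ι] [IsDomain R]

theorem gram_extendPairing (S : Type*) [CommRing S] [IsDomain S] [Algebra R S] [FaithfulSMul R S]
    [Algebra S L] [IsScalarTower R S L] (B : M →ₗ[R] M →ₗ[R] L) :
    (c.baseChange S).gram (extendPairing S B) = c.gram B := by
  ext i j
  simp [TorsionCoord.gram, TorsionCoord.baseChange]

variable [FaithfulSMul R L]

theorem linearMap_eq_zero_of_mem_torsion (f : M →ₗ[R] L) {x : M}
    (hx : x ∈ Submodule.torsion R M) : f x = 0 := by
  obtain ⟨a, ha⟩ := hx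
  have ha' : (a : R) • x = 0 := ha
  have h := congrArg f ha'
  rw [map_smul, map_zero, Algebra.smul_def] at h
  exact (mul_eq_zero.mp h).resolve_left ((map_ne_zero_iff _
    (FaithfulSMul.algebraMap_injective R L)).mpr (nonZeroDivisors.coe_ne_zero a))

/-- Linear maps to a field are determined by their values on coordinates modulo torsion. -/
def evalGen : (M →ₗ[R] L) ≃ₗ[L] (ι → L) :=
  LinearEquiv.ofBijective
    ({ toFun := fun f i => f (c.gen i), map_add' := fun _ _ => rfl, map_smul' := fun _ _ => rfl } :
      (M →ₗ[R] L) →ₗ[L] (ι → L))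
    ⟨by
      intro f g h
      ext x
      have hx := linearMap_eq_zero_of_mem_torsion (f - g) (c.sub_sum_mem_torsion x)
      have h0 : ∀ i, (f - g) (c.gen i) = 0 := fun i => sub_eq_zero.mpr (congrFun h i)
      rw [map_sub, map_sum] at hx
      simp only [map_smul, h0, smul_zero, Finset.sum_const_zero, sub_zero] at hx
      exact sub_eq_zero.mp hx, by
      intro v
      refine ⟨∑ i, (Algebra.linearMap R L ∘ₗ LinearMap.proj i ∘ₗ c.coord).smulRight (v i), ?_⟩
      ext j
      simp [c.coord_gen, Pi.single_apply, Finset.sum_apply]⟩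

@[simp]
theorem evalGen_apply (f : M →ₗ[R] L) (i : ι) : evalGen c f i = f (c.gen i) := rfl

/-- In the basis of `L ⊗ M` given by `c` and the coordinates `evalGen` on `Hom_R(M, L)`, the map
defined by the pairing is `v ↦ v · gram`. -/
theorem isNondegeneratePairing_iff (B : M →ₗ[R] M →ₗ[R] L) :
    IsNondegeneratePairing B ↔ (c.gram B).det ≠ 0 := by
  let b := (c.baseChange L).basis
  have h : ∀ v : ι → L, evalGen c (LinearMap.liftBaseChange L B (b.equivFun.symm v)) =
      Matrix.vecMul v (c.gram B) := by
    intro v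
    ext j
    simp [b, Module.Basis.equivFun_symm_apply, TorsionCoord.baseChange, TorsionCoord.gram,
      Matrix.vecMul, dotProduct]
  have h' : (fun v => Matrix.vecMul v (c.gram B)) =
      (evalGen c) ∘ (LinearMap.liftBaseChange L B) ∘ b.equivFun.symm := by
    funext v
    exact (h v).symm
  rw [← isUnit_iff_ne_zero, ← Matrix.isUnit_iff_isUnit_det, IsNondegeneratePairing]
  constructor
  · intro hB
    rw [← Matrix.vecMul_injective_iff_isUnit, show (c.gram B).vecMul = _ from h']
    exact (evalGen c).injective.comp (hB.1.comp b.equivFun.symm.injective)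
  · intro hB
    have h₁ := Matrix.vecMul_injective_iff_isUnit.mpr hB
    have h₂ := Matrix.vecMul_surjective_iff_isUnit.mpr hB
    have : Function.Bijective
        ((evalGen c) ∘ (LinearMap.liftBaseChange L B) ∘ b.equivFun.symm) := by
      rw [← h']; exact ⟨h₁, h₂⟩
    have := (Function.Bijective.of_comp_iff' (evalGen c).bijective _).mp this
    exact (Function.Bijective.of_comp_iff _ b.equivFun.symm.bijective).mp this

end Pairings

/-! ### The local factors of the regulator product -/

section RegTerm

/-- The orthogonal sum of pairings. -/
def piPairing {R L κ : Type*} [CommRing R] [Field L] [Algebra R L] [Fintype κ]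
    {F : κ → Type*} [∀ j, AddCommGroup (F j)] [∀ j, Module R (F j)]
    (B : ∀ j, F j →ₗ[R] F j →ₗ[R] L) : (∀ j, F j) →ₗ[R] (∀ j, F j) →ₗ[R] L :=
  ∑ j, (B j).compl₁₂ (LinearMap.proj j) (LinearMap.proj j)

theorem piPairing_apply {R L κ : Type*} [CommRing R] [Field L] [Algebra R L] [Fintype κ]
    {F : κ → Type*} [∀ j, AddCommGroup (F j)] [∀ j, Module R (F j)]
    (B : ∀ j, F j →ₗ[R] F j →ₗ[R] L) (x y : ∀ j, F j) :
    piPairing B x y = ∑ j, B j (x j) (y j) := by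
  simp [piPairing, LinearMap.sum_apply]

variable {R L : Type*} [CommRing R] [IsDomain R] [IsPrincipalIdealRing R] [Field L] [Algebra R L]
  [FaithfulSMul R L]

/-- The factor `cont(tors F)⁻² det(B | F / tors F)` of the regulator product. -/
def regTerm {F : Type*} [AddCommGroup F] [Module R F] (B : F →ₗ[R] F →ₗ[R] L) : UnitClass R L :=
  (contentSqClass R L (Submodule.torsion R F))⁻¹ * detClass (modTorsion B)

section

variable {F F' : Type*} [AddCommGroup F] [Module R F] [AddCommGroup F'] [Module R F']
variable {ι : Type*} [Fintype ι] [DecidableEq ι]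

/-- The torsion submodules of isomorphic modules are isomorphic. -/
def torsionCongr (e : F ≃ₗ[R] F') : Submodule.torsion R F ≃ₗ[R] Submodule.torsion R F' :=
  e.ofSubmodules _ _ (by
    ext y
    simp only [Submodule.mem_map, Submodule.mem_torsion_iff]
    constructor
    · rintro ⟨x, ⟨a, ha⟩, rfl⟩
      refine ⟨a, ?_⟩
      rw [Submonoid.smul_def] at ha ⊢
      exact (e.map_smul (a : R) x).symm.trans (by rw [ha, map_zero])
    · rintro ⟨a, ha⟩
      refine ⟨e.symm y, ⟨a, ?_⟩, by simp⟩
      rw [Submonoid.smul_def] at ha ⊢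
      rw [← map_smul, ha, map_zero])

theorem regTerm_congr (c : TorsionCoord R F ι) (e : F ≃ₗ[R] F') (B : F →ₗ[R] F →ₗ[R] L)
    (B' : F' →ₗ[R] F' →ₗ[R] L) (h : ∀ x y, B' (e x) (e y) = B x y) (hB : (c.gram B).det ≠ 0) :
    regTerm B = regTerm B' := by
  have e' : (c.map e).gram B' = c.gram B := by
    ext i j
    exact h _ _
  rw [regTerm, regTerm, contentSqClass_congr (torsionCongr e), detClass_modTorsion_eq B c hB,
    detClass_modTorsion_eq B' (c.map e) (by rwa [e'])]
  simp only [e']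

/-- The torsion submodule of a finite product. -/
def torsionPi {κ : Type*} [Fintype κ] (F : κ → Type*) [∀ j, AddCommGroup (F j)]
    [∀ j, Module R (F j)] :
    Submodule.torsion R (∀ j, F j) ≃ₗ[R] ∀ j, Submodule.torsion R (F j) where
  toFun x j := ⟨x.1 j, (mem_torsion_pi x.1).mp x.2 j⟩
  invFun x := ⟨fun j => (x j).1, (mem_torsion_pi _).mpr fun j => (x j).2⟩
  map_add' _ _ := rfl
  map_smul' _ _ := rfl
  left_inv _ := rfl
  right_inv _ := rfl

theorem gram_piPairing {κ : Type*} [Fintype κ] [DecidableEq κ] {F : κ → Type*}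
    [∀ j, AddCommGroup (F j)] [∀ j, Module R (F j)] {ν : κ → Type*}
    [∀ j, DecidableEq (ν j)] (c : ∀ j, TorsionCoord R (F j) (ν j))
    (B : ∀ j, F j →ₗ[R] F j →ₗ[R] L) :
    (TorsionCoord.pi c).gram (piPairing B) = Matrix.blockDiagonal' fun j => (c j).gram (B j) := by
  ext ⟨j, i⟩ ⟨j', i'⟩
  simp only [TorsionCoord.gram, TorsionCoord.pi, Matrix.of_apply, piPairing_apply,
    Matrix.blockDiagonal'_apply]
  rw [Finset.sum_eq_single j]
  · split_ifs with h
    · subst h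
      simp
    · simp [Pi.single_eq_of_ne h]
  · intro k _ hk
    simp [Pi.single_eq_of_ne hk]
  · simp

/-- The Gram matrix of an orthogonal sum is block diagonal, and content is multiplicative on
products. -/
theorem regTerm_pi {κ : Type*} [Fintype κ] [DecidableEq κ] {F : κ → Type*}
    [∀ j, AddCommGroup (F j)] [∀ j, Module R (F j)] [∀ j, Module.Finite R (F j)] {ν : κ → Type*}
    [∀ j, Fintype (ν j)] [∀ j, DecidableEq (ν j)] (c : ∀ j, TorsionCoord R (F j) (ν j))
    (B : ∀ j, F j →ₗ[R] F j →ₗ[R] L) (hB : ∀ j, ((c j).gram (B j)).det ≠ 0) :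
    ((TorsionCoord.pi c).gram (piPairing B)).det ≠ 0 ∧
      regTerm (piPairing B) = ∏ j, regTerm (B j) := by
  have hd : ((TorsionCoord.pi c).gram (piPairing B)).det = ∏ j, ((c j).gram (B j)).det := by
    rw [gram_piPairing, det_blockDiagonal']
  have hne : ((TorsionCoord.pi c).gram (piPairing B)).det ≠ 0 := by
    rw [hd]
    exact Finset.prod_ne_zero_iff.mpr fun j _ => hB j
  refine ⟨hne, ?_⟩
  have ht : ∀ j, Module.IsTorsion R (Submodule.torsion R (F j)) :=
    fun j => Submodule.torsion_isTorsion
  simp only [regTerm]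
  rw [Finset.prod_mul_distrib, Finset.prod_inv_distrib, contentSqClass_congr (torsionPi F),
    contentSqClass_pi _ ht, detClass_modTorsion_eq _ _ hne]
  congr 1
  simp only [fun j => detClass_modTorsion_eq (B j) (c j) (hB j)]
  rw [← QuotientGroup.coe_mk', ← map_prod]
  congr 1
  ext
  simp [hd]

end

section BaseChange

variable {F : Type*} [AddCommGroup F] [Module R F] {ι : Type*} [Fintype ι] [DecidableEq ι]

/-- The torsion submodule commutes with extension of scalars. -/
def torsionBaseChange (c : TorsionCoord R F ι) (S : Type*) [CommRing S] [IsDomain S] [Algebra R S]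
    [FaithfulSMul R S] :
    S ⊗[R] Submodule.torsion R F ≃ₗ[S] Submodule.torsion S (S ⊗[R] F) :=
  (LinearEquiv.ofInjective ((Submodule.torsion R F).subtype.baseChange S)
    (Module.Flat.lTensor_preserves_injective_linearMap _
      (Submodule.torsion R F).injective_subtype)).trans
    (LinearEquiv.ofEq _ _ (by
      rw [← (c.baseChange S).ker_coord, TorsionCoord.baseChange, LinearEquiv.ker_comp]
      have h := LinearMap.exact_subtype_ker_map c.coord
      rw [c.ker_coord] at h
      ext z
      exact (lTensor_exact S h c.coord_surjective z).symm))

theorem unitClassMap_contentSqClass (S E : Type*) [CommRing S] [IsDomain S]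
    [IsPrincipalIdealRing S] [Algebra R S] [FaithfulSMul R S] [Field E] [Algebra S E]
    [FaithfulSMul S E] [Algebra L E] [Algebra R E] [IsScalarTower R L E] [IsScalarTower R S E]
    (T : Type*) [AddCommGroup T] [Module R T] [Module.Finite R T] (hT : Module.IsTorsion R T) :
    unitClassMap R L S E (contentSqClass R L T) = contentSqClass S E (S ⊗[R] T) := by
  rw [contentSqClass_eq (T := S ⊗[R] T) (a := algebraMap R S (contentGen R T))
    ((map_ne_zero_iff _ (FaithfulSMul.algebraMap_injective R S)).mpr (contentGen_ne_zero R T))]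
  · refine congrArg QuotientGroup.mk ?_
    ext
    simp [unitOf, ← IsScalarTower.algebraMap_apply]
  · rw [contentIdeal_baseChange S T hT, ← Set.image_singleton, ← Ideal.map_span]
    congr 1
    exact (Ideal.span_singleton_generator _).symm

/-- Torsion and content commute with extension to `S`, and in the extended coordinates the Gram
matrix is the old one with entries viewed in `E`. -/
theorem unitClassMap_regTerm [Module.Finite R F] (c : TorsionCoord R F ι) (S E : Type*) [CommRing S]
    [IsDomain S] [IsPrincipalIdealRing S] [Algebra R S] [FaithfulSMul R S] [Field E] [Algebra S E]
    [FaithfulSMul S E] [Algebra L E] [Algebra R E] [IsScalarTower R L E] [IsScalarTower R S E]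
    (B : F →ₗ[R] F →ₗ[R] L) (hB : (c.gram B).det ≠ 0) :
    regTerm (extendPairing S (mapPairing E B)) = unitClassMap R L S E (regTerm B) := by
  have hg : ((c.baseChange S).gram (extendPairing S (mapPairing E B))).det =
      algebraMap L E (c.gram B).det := by
    have : FaithfulSMul R E := FaithfulSMul.trans R S E
    rw [gram_extendPairing, gram_mapPairing, RingHom.map_det, RingHom.mapMatrix_apply]
  have hne : ((c.baseChange S).gram (extendPairing S (mapPairing E B))).det ≠ 0 := by
    rw [hg]
    simpa using hB
  rw [regTerm, regTerm, map_mul, map_inv,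
    unitClassMap_contentSqClass S E _ Submodule.torsion_isTorsion,
    ← contentSqClass_congr (torsionBaseChange c S), detClass_modTorsion_eq _ _ hne,
    detClass_modTorsion_eq _ _ hB]
  congr 1
  refine congrArg QuotientGroup.mk ?_
  ext
  simp [hg]

theorem unitClassMap_contentSqClass_self (E : Type*) [Field E]
    [Algebra L E] [Algebra R E] [FaithfulSMul R E] [IsScalarTower R L E]
    (T : Type*) [AddCommGroup T] [Module R T] :
    unitClassMap R L R E (contentSqClass R L T) = contentSqClass R E T := by
  refine congrArg QuotientGroup.mk ?_
  ext
  simp [← IsScalarTower.algebraMap_apply]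

theorem unitClassMap_regTerm_self (c : TorsionCoord R F ι) (E : Type*) [Field E]
    [Algebra L E] [Algebra R E] [FaithfulSMul R E] [IsScalarTower R L E]
    (B : F →ₗ[R] F →ₗ[R] L) (hB : (c.gram B).det ≠ 0) :
    regTerm (mapPairing E B) = unitClassMap R L R E (regTerm B) := by
  have hg : (c.gram (mapPairing E B)).det = algebraMap L E (c.gram B).det := by
    rw [gram_mapPairing, RingHom.map_det, RingHom.mapMatrix_apply]
  have hne : (c.gram (mapPairing E B)).det ≠ 0 := by
    rw [hg]
    simpa using hB
  rw [regTerm, regTerm, map_mul, map_inv, unitClassMap_contentSqClass_self,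
    detClass_modTorsion_eq _ _ hne, detClass_modTorsion_eq _ _ hB]
  congr 1
  refine congrArg QuotientGroup.mk ?_
  ext
  simp [hg]

end BaseChange

end RegTerm

/-! ### Independence of the pairing -/

section Restriction

variable {L V ι : Type*} [Field L] [AddCommGroup V] [Module L V] [Fintype ι] [DecidableEq ι]
  {W : Submodule L V} (b : Module.Basis ι L W)

theorem det_restrict_ne_zero (Q : V →ₗ[L] V →ₗ[L] L)
    (hQ : ∀ x : W, (∀ y : W, Q x y = 0) → x = 0) :
    (Matrix.of fun i j => Q (b i) (b j)).det ≠ 0 := fun h => by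
  obtain ⟨v, hv, hv'⟩ := Matrix.exists_vecMul_eq_zero_iff.mpr h
  have hw : ∀ j, Q ((∑ i, v i • b i : W) : V) (b j) = 0 := fun j => by
    refine Eq.trans ?_ (congrFun hv' j)
    simp [Matrix.vecMul, dotProduct]
  have h0 : ∑ i, v i • b i = 0 := hQ _ fun y => by
    have : Q ((∑ i, v i • b i : W) : V) ∘ₗ W.subtype = 0 := b.ext fun j => by simpa using hw j
    exact LinearMap.congr_fun this y
  exact hv (funext (Fintype.linearIndependent_iff.mp b.linearIndependent v h0))

/-- The Gram matrix of `Q₂` is the transposed matrix of `A'` times that of `Q₁`. -/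
theorem det_restrict_eq {Q₁ Q₂ : V →ₗ[L] V →ₗ[L] L} (A : V →ₗ[L] V) (A' : W →ₗ[L] W)
    (hA : ∀ x y, Q₁ (A x) y = Q₂ x y) (hA' : ∀ x : W, (A' x : V) = A x) :
    (Matrix.of fun i j => Q₂ (b i) (b j)).det =
      LinearMap.det A' * (Matrix.of fun i j => Q₁ (b i) (b j)).det := by
  rw [← LinearMap.det_toMatrix b, ← Matrix.det_transpose (LinearMap.toMatrix b b A'),
    ← Matrix.det_mul]
  congr 1
  ext i j
  have : (A' (b i) : V) = ∑ k, b.repr (A' (b i)) k • (b k : V) := by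
    conv_lhs => rw [← b.sum_repr (A' (b i))]
    simp only [Submodule.coe_sum, Submodule.coe_smul]
  rw [Matrix.of_apply, ← hA, ← hA', this]
  simp [Matrix.mul_apply, LinearMap.toMatrix_apply]

end Restriction

section Independence

variable {R L : Type*} [CommRing R] [IsDomain R] [IsPrincipalIdealRing R] [Field L] [Algebra R L]
  [FaithfulSMul R L]
variable {G : Type*} [Group G] {M : Type*} [AddCommGroup M] [Module R M]
  (ρ : Representation R G M)

/-- The pairing `|H|⁻¹ ⟨ , ⟩` on `M^H`. -/
def fixedPairing (H : Subgroup G) (B : M →ₗ[R] M →ₗ[R] L) :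
    fixedBy ρ H →ₗ[R] fixedBy ρ H →ₗ[R] L :=
  (Nat.card H : L)⁻¹ • B.domRestrict₁₂ (fixedBy ρ H) (fixedBy ρ H)

theorem fixedPairing_apply (H : Subgroup G) (B : M →ₗ[R] M →ₗ[R] L) (x y : fixedBy ρ H) :
    fixedPairing ρ H B x y = (Nat.card H : L)⁻¹ * B x y := rfl

/-- `(tors M)^H` is the torsion submodule of `M^H`. -/
def torsionFixedByEquiv (H : Subgroup G) :
    torsionFixedBy ρ H ≃ₗ[R] Submodule.torsion R (fixedBy ρ H) where
  toFun x := ⟨⟨x.1, x.2.2⟩, by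
    obtain ⟨a, ha⟩ := x.2.1
    exact ⟨a, Subtype.ext ha⟩⟩
  invFun x := ⟨x.1.1, by
    obtain ⟨a, ha⟩ := x.2
    exact ⟨⟨a, congrArg Subtype.val ha⟩, x.1.2⟩⟩
  map_add' _ _ := rfl
  map_smul' _ _ := rfl
  left_inv _ := rfl
  right_inv _ := rfl

theorem regulatorProduct_eq (Θ : Subgroup G →₀ ℤ) (B : M →ₗ[R] M →ₗ[R] L) :
    regulatorProduct Θ ρ B = Θ.prod fun H n => regTerm (fixedPairing ρ H B) ^ n := by
  refine Finsupp.prod_congr fun H _ => ?_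
  rw [contentSqClass_congr (torsionFixedByEquiv ρ H)]
  rfl

theorem card_subgroup_ne_zero {k : Type*} [Field k] [Finite G] (hG : (Nat.card G : k) ≠ 0)
    (H : Subgroup G) : (Nat.card H : k) ≠ 0 := fun h => by
  obtain ⟨m, hm⟩ := H.card_subgroup_dvd_card
  apply hG
  rw [hm, Nat.cast_mul, h, zero_mul]

theorem isInvariant_extendPairing {ρ : Representation R G M} {B : M →ₗ[R] M →ₗ[R] L}
    (hB : IsInvariantPairing ρ B) (S : Type*) [CommRing S] [Algebra R S] [Algebra S L]
    [IsScalarTower R S L] : IsInvariantPairing (extendScalars S ρ) (extendPairing S B) := by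
  intro g x y
  induction x with
  | zero => simp
  | add x x' hx hx' => simp only [map_add, LinearMap.add_apply, hx, hx']
  | tmul s m =>
    induction y with
    | zero => simp
    | add y y' hy hy' => simp only [map_add, hy, hy']
    | tmul t n => simp [hB g m n]

variable [Finite G]

/-- Fixed spaces commute with flat base change. -/
def fixedBaseChange (S : Type*) [CommRing S] [Algebra R S] [Module.Flat R S] (H : Subgroup G) :
    S ⊗[R] fixedBy ρ H ≃ₗ[S] fixedBy (extendScalars S ρ) H :=
  invariantsBaseChange S (ρ.comp H.subtype)

theorem coe_fixedBaseChange_tmul (S : Type*) [CommRing S] [Algebra R S] [Module.Flat R S]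
    (H : Subgroup G) (s : S) (x : fixedBy ρ H) :
    (fixedBaseChange ρ S H (s ⊗ₜ x) : S ⊗[R] M) = s ⊗ₜ (x : M) := rfl

variable {ι : Type*} [Fintype ι] [DecidableEq ι] {H : Subgroup G}
  (c : TorsionCoord R (fixedBy ρ H) ι)

variable (L) in
/-- The basis of the fixed space `(L ⊗ M)^H` given by coordinates modulo torsion of `M^H`. -/
def fixedBasis : Module.Basis ι L (fixedBy (extendScalars L ρ) H) :=
  TorsionCoord.basis (V := fixedBy (extendScalars L ρ) H)
    (TorsionCoord.map (F' := fixedBy (extendScalars L ρ) H) (c.baseChange L)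
      (fixedBaseChange ρ L H))

theorem coe_fixedBasis (i : ι) : (fixedBasis L ρ c i : L ⊗[R] M) = 1 ⊗ₜ (c.gen i : M) := by
  simp only [fixedBasis, TorsionCoord.basis_apply]
  rfl

theorem extendPairing_fixedBasis (B : M →ₗ[R] M →ₗ[R] L) (i j : ι) :
    extendPairing L B (fixedBasis L ρ c i) (fixedBasis L ρ c j) = B (c.gen i) (c.gen j) := by
  rw [coe_fixedBasis, coe_fixedBasis]
  simp

/-- Averaging: for any `m`, the sum of its translates under `H` is fixed by `H` and pairs with the
fixed vector `x` to `|H| ⟨x, m⟩`. As `|H| ≠ 0` in `L`, `x` is orthogonal to every `m`. -/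
theorem eq_zero_of_extendPairing_fixedBy (hG : (Nat.card G : L) ≠ 0) {B : M →ₗ[R] M →ₗ[R] L}
    (hB : IsInvariantPairing ρ B) (hB' : IsNondegeneratePairing B)
    (x : fixedBy (extendScalars L ρ) H)
    (hx : ∀ y : fixedBy (extendScalars L ρ) H, extendPairing L B x y = 0) : x = 0 := by
  have := Fintype.ofFinite H
  have hinv := isInvariant_extendPairing hB L
  have hx' := mem_fixedBy.mp x.2
  ext1
  apply hB'.1
  rw [Submodule.coe_zero, map_zero]
  ext m
  let y : L ⊗[R] M := ∑ h : H, extendScalars L ρ h (1 ⊗ₜ m)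
  have hy : y ∈ fixedBy (extendScalars L ρ) H := by
    rw [mem_fixedBy]
    intro h hh
    simp only [y, map_sum, ← Module.End.mul_apply, ← map_mul]
    exact Fintype.sum_equiv (Equiv.mulLeft (⟨h, hh⟩ : H))
      (fun g : H => extendScalars L ρ (h * g) (1 ⊗ₜ[R] m))
      (fun g : H => extendScalars L ρ g (1 ⊗ₜ[R] m)) fun g => by
        rw [Equiv.coe_mulLeft, Subgroup.coe_mul]
  have h₁ := hx ⟨y, hy⟩
  have h₂ : extendPairing L B x y = (Nat.card H : L) * extendPairing L B x (1 ⊗ₜ m) := by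
    simp only [y, map_sum]
    rw [Finset.sum_congr rfl fun (h : H) _ => by
      rw [← hx' h h.2, hinv], Finset.sum_const, Finset.card_univ, nsmul_eq_mul,
      Nat.card_eq_fintype_card]
  have h₃ := (mul_eq_zero.mp (h₂.symm.trans h₁)).resolve_left (card_subgroup_ne_zero hG H)
  have h₄ : ∀ z : L ⊗[R] M, LinearMap.liftBaseChange L B z m = extendPairing L B z (1 ⊗ₜ m) := by
    intro z
    induction z with
    | zero => simp
    | add a b ha hb => simp only [map_add, LinearMap.add_apply, ha, hb]
    | tmul s n => simp
  exact (h₄ x).trans h₃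

theorem gram_fixedPairing (B : M →ₗ[R] M →ₗ[R] L) :
    c.gram (fixedPairing ρ H B) = (Nat.card H : L)⁻¹ • Matrix.of fun i j =>
      extendPairing L B (fixedBasis L ρ c i) (fixedBasis L ρ c j) := by
  ext i j
  simp only [extendPairing_fixedBasis]
  rfl

theorem det_gram_fixedPairing_ne_zero (hG : (Nat.card G : L) ≠ 0) {B : M →ₗ[R] M →ₗ[R] L}
    (hB : IsInvariantPairing ρ B) (hB' : IsNondegeneratePairing B) :
    (c.gram (fixedPairing ρ H B)).det ≠ 0 := by
  rw [gram_fixedPairing, Matrix.det_smul]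
  refine mul_ne_zero (pow_ne_zero _ (inv_ne_zero (card_subgroup_ne_zero hG H))) ?_
  exact det_restrict_ne_zero (fixedBasis L ρ c) _ (eq_zero_of_extendPairing_fixedBy ρ hG hB hB')

/-- The endomorphism of `L ⊗ M` relating two pairings. -/
theorem exists_linearMap_extendPairing {B₁ : M →ₗ[R] M →ₗ[R] L} (h₁ : IsInvariantPairing ρ B₁)
    (h₁' : IsNondegeneratePairing B₁) {B₂ : M →ₗ[R] M →ₗ[R] L} (h₂ : IsInvariantPairing ρ B₂) :
    ∃ A : L ⊗[R] M →ₗ[L] L ⊗[R] M,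
      (∀ x y, extendPairing L B₁ (A x) y = extendPairing L B₂ x y) ∧
      ∀ g x, A (extendScalars L ρ g x) = extendScalars L ρ g (A x) := by
  have e : ∀ (B : M →ₗ[R] M →ₗ[R] L) (z : L ⊗[R] M), extendPairing L B z =
      LinearMap.liftBaseChange L (LinearMap.liftBaseChange L B z) := by
    intro B z
    induction z with
    | zero => ext; simp
    | add a b ha hb => ext; simp [ha, hb]
    | tmul s n => ext; simp
  let Φ := LinearEquiv.ofBijective _ h₁'
  let A := Φ.symm.toLinearMap ∘ₗ LinearMap.liftBaseChange L B₂
  have hA : ∀ x y, extendPairing L B₁ (A x) y = extendPairing L B₂ x y := by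
    intro x y
    have : LinearMap.liftBaseChange L B₁ (A x) = LinearMap.liftBaseChange L B₂ x :=
      Φ.apply_symm_apply _
    rw [e, e, this]
  -- Equivariance follows from nondegeneracy of `B₁`: `⟨A g x, y⟩₁ = ⟨g x, y⟩₂ = ⟨x, g⁻¹ y⟩₂ = ⟨A x,
  -- g⁻¹ y⟩₁ = ⟨g A x, y⟩₁`.
  refine ⟨A, hA, fun g x => h₁'.1 ?_⟩
  apply (LinearMap.liftBaseChangeEquiv L).injective
  change LinearMap.liftBaseChange L _ = LinearMap.liftBaseChange L _
  rw [← e, ← e]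
  apply LinearMap.ext
  intro y
  have hi : extendScalars L ρ g (extendScalars L ρ g⁻¹ y) = y := by
    rw [← Module.End.mul_apply, ← map_mul]; simp
  rw [hA, ← hi, isInvariant_extendPairing h₂ L, isInvariant_extendPairing h₁ L, hA]

theorem det_gram_fixedPairing_eq {B₁ B₂ : M →ₗ[R] M →ₗ[R] L}
    (A : L ⊗[R] M →ₗ[L] L ⊗[R] M)
    (hA : ∀ x y, extendPairing L B₁ (A x) y = extendPairing L B₂ x y)
    (hA' : ∀ g x, A (extendScalars L ρ g x) = extendScalars L ρ g (A x)) :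
    (c.gram (fixedPairing ρ H B₂)).det =
      LinearMap.det (M := fixedBy (extendScalars L ρ) H) (fixedMap (extendScalars L ρ) A hA' H) *
        (c.gram (fixedPairing ρ H B₁)).det := by
  rw [gram_fixedPairing, gram_fixedPairing, Matrix.det_smul, Matrix.det_smul,
    det_restrict_eq (fixedBasis L ρ c) A (fixedMap (extendScalars L ρ) A hA' H) hA fun x => rfl]
  ring

end Independence

section Independence

variable {R L : Type*} [CommRing R] [IsDomain R] [IsPrincipalIdealRing R] [Field L] [Algebra R L]
  [FaithfulSMul R L]
variable {G : Type*} [Group G] [Finite G] {M : Type*} [AddCommGroup M] [Module R M]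
  [Module.Finite R M] (ρ : Representation R G M)

/-- The regulator product does not depend on the pairing. -/
theorem regulatorProduct_eq_of_pairings (hG : (Nat.card G : L) ≠ 0) (Θ : Subgroup G →₀ ℤ)
    (hΘ : IsBrauerRelation Θ) {B₁ B₂ : M →ₗ[R] M →ₗ[R] L} (h₁ : IsInvariantPairing ρ B₁)
    (h₁' : IsNondegeneratePairing B₁) (h₂ : IsInvariantPairing ρ B₂)
    (h₂' : IsNondegeneratePairing B₂) : regulatorProduct Θ ρ B₁ = regulatorProduct Θ ρ B₂ := by
  classical
  obtain ⟨A, hA, hA'⟩ := exists_linearMap_extendPairing ρ h₁ h₁' h₂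
  choose n c using fun H : Subgroup G => TorsionCoord.exists_fin (R := R) (F := fixedBy ρ H)
  let c := fun H => (c H).some
  have hdet := fun H => det_gram_fixedPairing_eq ρ (c H) A hA hA'
  have hne₁ := fun H => det_gram_fixedPairing_ne_zero ρ (c H) hG h₁ h₁'
  have hne₂ := fun H => det_gram_fixedPairing_ne_zero ρ (c H) hG h₂ h₂'
  have hu : ∀ H, LinearMap.det (M := fixedBy (extendScalars L ρ) H)
      (fixedMap (extendScalars L ρ) A hA' H) ≠ 0 := fun H h => by
    apply hne₂ H
    rw [hdet, h, zero_mul]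
  let u : Subgroup G → Lˣ := fun H => Units.mk0 _ (hu H)
  -- The Brauer relation enters here. The ratio of the two products is `1` in `Lˣ` itself, before
  -- squares of units are factored out.
  have hprod := prod_det_fixedMap_eq_one (extendScalars L ρ) hG Θ hΘ A hA' u fun H => rfl
  have hterm : ∀ H, regTerm (fixedPairing ρ H B₂) =
      QuotientGroup.mk' (unitSquares R L) (u H) * regTerm (fixedPairing ρ H B₁) := fun H => by
    have : (QuotientGroup.mk (Units.mk0 _ (hne₂ H)) : UnitClass R L) =
        QuotientGroup.mk' (unitSquares R L) (u H) * QuotientGroup.mk (Units.mk0 _ (hne₁ H)) := by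
      rw [QuotientGroup.mk'_apply, ← QuotientGroup.mk_mul]
      congr 1
      ext
      exact hdet H
    rw [regTerm, regTerm, detClass_modTorsion_eq _ (c H) (hne₁ H),
      detClass_modTorsion_eq _ (c H) (hne₂ H), this]
    exact mul_left_comm (G := UnitClass R L) _ _ _
  have hone : (Θ.prod fun H n => QuotientGroup.mk' (unitSquares R L) (u H) ^ n) = 1 := by
    rw [← map_one (QuotientGroup.mk' (unitSquares R L)), ← hprod, map_finsuppProd]
    simp only [map_zpow]
  rw [regulatorProduct_eq, regulatorProduct_eq, ← one_mul (Finsupp.prod _ _), ← hone,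
    ← Finsupp.prod_mul]
  refine Finsupp.prod_congr fun H _ => ?_
  rw [hterm]
  exact (mul_zpow (α := UnitClass R L) _ _ _).symm

end Independence

/-! ### Self-duality and pairings -/

section SelfDual

variable {R : Type*} (L : Type*) [CommRing R] [IsDomain R] [IsPrincipalIdealRing R] [Field L]
  [Algebra R L] [FaithfulSMul R L]
variable {G : Type*} [Group G] {M : Type*} [AddCommGroup M] [Module R M] [Module.Finite R M]

/-- `L ⊗ Hom(M, R)` as the space of `L`-valued linear maps on `M`. -/
def dualBaseChange : L ⊗[R] Module.Dual R M ≃ₗ[L] (M →ₗ[R] L) :=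
  have := Module.finitePresentation_of_finite R M
  (homBaseChange M R L).trans <|
    ((LinearEquiv.refl L (L ⊗[R] M)).arrowCongr
      (TensorProduct.AlgebraTensorModule.rid R L L)).trans (LinearMap.liftBaseChangeEquiv L).symm

@[simp]
theorem dualBaseChange_tmul (s : L) (f : Module.Dual R M) (x : M) :
    dualBaseChange L (s ⊗ₜ f) x = s * algebraMap R L (f x) := by
  simp [dualBaseChange, Algebra.smul_def, mul_comm]

theorem dualBaseChange_dual (ρ : Representation R G M) (g : G) (z : L ⊗[R] Module.Dual R M)
    (x : M) : dualBaseChange L (extendScalars L ρ.dual g z) x = dualBaseChange L z (ρ g⁻¹ x) := by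
  induction z with
  | zero => simp
  | add a b ha hb => simp only [map_add, LinearMap.add_apply, ha, hb]
  | tmul s f => simp [Representation.dual_apply, Module.Dual.transpose_apply]

variable {L}

/-- Since `L ⊗ Hom_R(M, R) = Hom_R(M, L)`, a linear map from `L ⊗ M` to the dual is the same as a
pairing; equivariance becomes invariance, and bijectivity becomes nondegeneracy. -/
theorem isSelfDual_iff_exists_pairing (ρ : Representation R G M) :
    IsSelfDual R L ρ ↔
      ∃ B : M →ₗ[R] M →ₗ[R] L, IsInvariantPairing ρ B ∧ IsNondegeneratePairing B := by
  constructor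
  · rintro ⟨e⟩
    let Φ : L ⊗[R] M →ₗ[L] (M →ₗ[R] L) := (dualBaseChange L).toLinearMap ∘ₗ e.toLinearMap
    have hΦ : LinearMap.liftBaseChange L ((LinearMap.liftBaseChangeEquiv L).symm Φ) = Φ :=
      (LinearMap.liftBaseChangeEquiv L).apply_symm_apply Φ
    refine ⟨(LinearMap.liftBaseChangeEquiv L).symm Φ, fun g x y => ?_, ?_⟩
    · rw [LinearMap.liftBaseChangeEquiv_symm_apply, LinearMap.liftBaseChangeEquiv_symm_apply]
      have : e (1 ⊗ₜ ρ g x) = extendScalars L ρ.dual g (e (1 ⊗ₜ x)) :=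
        LinearMap.congr_fun (e.isIntertwining' g) (1 ⊗ₜ x)
      refine (congrArg (fun z => dualBaseChange L z (ρ g y)) this).trans ?_
      rw [dualBaseChange_dual, ← Module.End.mul_apply, ← map_mul, inv_mul_cancel, map_one]
      rfl
    · rw [IsNondegeneratePairing, hΦ]
      exact (dualBaseChange L).bijective.comp e.toLinearEquiv.bijective
  · rintro ⟨B, hB, hB'⟩
    let Φ : L ⊗[R] M ≃ₗ[L] (M →ₗ[R] L) := LinearEquiv.ofBijective _ hB'
    have hΦ : ∀ x, Φ (1 ⊗ₜ x) = B x := fun x =>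
      (LinearMap.liftBaseChange_tmul _ _ _ _).trans (one_smul _ _)
    refine ⟨.mk (Φ.trans (dualBaseChange L).symm) fun g => ?_⟩
    ext x
    apply (dualBaseChange L).injective
    ext y
    simp only [LinearMap.comp_apply, LinearEquiv.coe_coe, LinearEquiv.trans_apply,
      TensorProduct.AlgebraTensorModule.curry_apply, TensorProduct.curry_apply,
      LinearMap.restrictScalars_apply, LinearEquiv.apply_symm_apply, dualBaseChange_dual,
      extendScalars_tmul, hΦ]
    rw [← hB g⁻¹, ← Module.End.mul_apply, ← map_mul, inv_mul_cancel, map_one]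
    rfl

end SelfDual

/-! ### Computing the regulator constant from a pairing -/

section RegulatorConstant

variable {R K L : Type*} [CommRing R] [IsDomain R] [IsPrincipalIdealRing R]
    [Field K] [Algebra R K] [FaithfulSMul R K]
    [Field L] [Algebra K L] [Algebra R L] [IsScalarTower R K L] [FaithfulSMul R L]
    {G : Type*} [Group G] [Finite G] {M : Type*} [AddCommGroup M] [Module R M]
    [Module.Finite R M]

variable (K) in
/-- Pairings may be chosen with values in the smaller field. -/
theorem exists_pairing_of_isSelfDual (hG : (Nat.card G : K) ≠ 0) {ρ : Representation R G M}
    (h : IsSelfDual R L ρ) :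
    ∃ B : M →ₗ[R] M →ₗ[R] K, IsInvariantPairing ρ B ∧ IsNondegeneratePairing B :=
  (isSelfDual_iff_exists_pairing ρ).mp (nonempty_equiv_of_extendScalars L hG ρ ρ.dual h)

theorem regulatorConstant_eq (hG : (Nat.card G : K) ≠ 0) {Θ : Subgroup G →₀ ℤ}
    (hΘ : IsBrauerRelation Θ) (ρ : Representation R G M) {B : M →ₗ[R] M →ₗ[R] K}
    (hB : IsInvariantPairing ρ B) (hB' : IsNondegeneratePairing B) :
    regulatorConstant K Θ ρ = regulatorProduct Θ ρ B := by
  have h : ∃ B : M →ₗ[R] M →ₗ[R] K, IsInvariantPairing ρ B ∧ IsNondegeneratePairing B :=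
    ⟨B, hB, hB'⟩
  rw [regulatorConstant, dif_pos h]
  exact regulatorProduct_eq_of_pairings ρ hG Θ hΘ h.choose_spec.1 h.choose_spec.2 hB hB'

/-- The pairing chosen in the definition does not depend on `Θ`, which need not be a Brauer relation
here. Induced, restricted and inflated combinations can thus be evaluated without first showing that
they are Brauer relations. -/
theorem exists_regulatorConstant_eq {ρ : Representation R G M}
    (h : ∃ B : M →ₗ[R] M →ₗ[R] K, IsInvariantPairing ρ B ∧ IsNondegeneratePairing B) :
    ∃ B : M →ₗ[R] M →ₗ[R] K, IsInvariantPairing ρ B ∧ IsNondegeneratePairing B ∧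
      ∀ Θ, regulatorConstant K Θ ρ = regulatorProduct Θ ρ B :=
  ⟨h.choose, h.choose_spec.1, h.choose_spec.2, fun Θ => by rw [regulatorConstant, dif_pos h]⟩

theorem isInvariantPairing_mapPairing {ρ : Representation R G M} {B : M →ₗ[R] M →ₗ[R] K}
    (hB : IsInvariantPairing ρ B) : IsInvariantPairing ρ (mapPairing L B) := fun g x y => by
  rw [mapPairing_apply, mapPairing_apply, hB]

theorem isNondegeneratePairing_mapPairing {B : M →ₗ[R] M →ₗ[R] K}
    (hB : IsNondegeneratePairing B) : IsNondegeneratePairing (mapPairing L B) := by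
  obtain ⟨n, ⟨c⟩⟩ := TorsionCoord.exists_fin (R := R) (F := M)
  rw [isNondegeneratePairing_iff c] at hB ⊢
  rw [gram_mapPairing, ← RingHom.mapMatrix_apply, ← RingHom.map_det]
  exact (map_ne_zero _).mpr hB

theorem fixedPairing_mapPairing (ρ : Representation R G M) (H : Subgroup G)
    (B : M →ₗ[R] M →ₗ[R] K) :
    fixedPairing ρ H (mapPairing L B) = mapPairing L (fixedPairing ρ H B) := by
  ext x y
  simp [fixedPairing_apply]

end RegulatorConstant

/-! ### Independence of choices, induction, inflation and extension of scalars -/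

section Functoriality

variable {R K : Type*} [CommRing R] [IsDomain R] [IsPrincipalIdealRing R]
    [Field K] [Algebra R K] [FaithfulSMul R K] {G : Type*} [Group G] [Finite G]
    {M : Type*} [AddCommGroup M] [Module R M] [Module.Finite R M]

/-- The pairing `B` makes `M` self-dual over `L`, hence over `K` by Noether–Deuring. A `K`-valued
pairing then exists, and independence over `L` compares it with `B`. -/
theorem unitClassMap_regulatorConstant {L : Type*} [Field L] [Algebra K L] [Algebra R L]
    [IsScalarTower R K L] [FaithfulSMul R L] (hG : (Nat.card G : K) ≠ 0) {Θ : Subgroup G →₀ ℤ}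
    (hΘ : IsBrauerRelation Θ) (ρ : Representation R G M) {B : M →ₗ[R] M →ₗ[R] L}
    (hB : IsInvariantPairing ρ B) (hB' : IsNondegeneratePairing B) :
    unitClassMap R K R L (regulatorConstant K Θ ρ) = regulatorProduct Θ ρ B := by
  obtain ⟨B₀, h₀, h₀'⟩ := exists_pairing_of_isSelfDual K hG
    ((isSelfDual_iff_exists_pairing ρ).mpr ⟨B, hB, hB'⟩)
  have hG' : (Nat.card G : L) ≠ 0 := by
    rw [← map_natCast (algebraMap K L)]
    exact (map_ne_zero _).mpr hG
  rw [regulatorProduct_eq_of_pairings ρ hG' Θ hΘ hB hB' (isInvariantPairing_mapPairing h₀)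
    (isNondegeneratePairing_mapPairing h₀'), regulatorConstant_eq hG hΘ ρ h₀ h₀',
    regulatorProduct_eq, regulatorProduct_eq, map_finsuppProd]
  refine Finsupp.prod_congr fun H _ => ?_
  obtain ⟨n, ⟨c⟩⟩ := TorsionCoord.exists_fin (R := R) (F := fixedBy ρ H)
  rw [map_zpow, fixedPairing_mapPairing, unitClassMap_regTerm_self c L _
    (det_gram_fixedPairing_ne_zero ρ c hG h₀ h₀')]

theorem regTerm_fixedPairing_congr (hG : (Nat.card G : K) ≠ 0) {ρ : Representation R G M}
    {H : Subgroup G} {B : M →ₗ[R] M →ₗ[R] K} (hB : IsInvariantPairing ρ B)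
    (hB' : IsNondegeneratePairing B) {G' : Type*} [Group G'] {ρ' : Representation R G' M}
    {H' : Subgroup G'} {B' : M →ₗ[R] M →ₗ[R] K} (hH : fixedBy ρ H = fixedBy ρ' H')
    (h : ∀ x y, (Nat.card H' : K)⁻¹ * B' x y = (Nat.card H : K)⁻¹ * B x y) :
    regTerm (fixedPairing ρ H B) = regTerm (fixedPairing ρ' H' B') := by
  obtain ⟨n, ⟨c⟩⟩ := TorsionCoord.exists_fin (R := R) (F := fixedBy ρ H)
  exact regTerm_congr c (LinearEquiv.ofEq _ _ hH) _ _ (fun x y => h x y)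
    (det_gram_fixedPairing_ne_zero ρ c hG hB hB')

theorem regulatorProduct_mapDomain {G' : Type*} [Group G'] (ρ : Representation R G M)
    (B : M →ₗ[R] M →ₗ[R] K) (Θ : Subgroup G' →₀ ℤ) (f : Subgroup G' → Subgroup G) :
    regulatorProduct (Θ.mapDomain f) ρ B =
      Θ.prod fun H n => regTerm (fixedPairing ρ (f H) B) ^ n := by
  rw [regulatorProduct_eq]
  exact Finsupp.prod_mapDomain_index (fun _ => zpow_zero _) (fun _ _ _ => zpow_add _ _ _)

/-- One pairing serves both groups, because `H` and its image have the same order and the same fixed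
submodule. -/
theorem regulatorConstant_indRel {G' : Type*} [Group G'] [Finite G'] (hG : (Nat.card G : K) ≠ 0)
    {ι : G' →* G} (hι : Function.Injective ι) {Θ : Subgroup G' →₀ ℤ} (hΘ : IsBrauerRelation Θ)
    {ρ : Representation R G M}
    (h : ∃ B : M →ₗ[R] M →ₗ[R] K, IsInvariantPairing ρ B ∧ IsNondegeneratePairing B) :
    regulatorConstant K (indRel ι Θ) ρ = regulatorConstant K Θ (ρ.comp ι) := by
  obtain ⟨B, hB, hB', hreg⟩ := exists_regulatorConstant_eq h
  have hG' : (Nat.card G' : K) ≠ 0 := by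
    rw [Nat.card_congr (MonoidHom.ofInjective hι).toEquiv]
    exact card_subgroup_ne_zero hG _
  have hBι : IsInvariantPairing (ρ.comp ι) B := fun g => hB (ι g)
  rw [hreg, regulatorConstant_eq hG' hΘ _ hBι hB', indRel, regulatorProduct_mapDomain,
    regulatorProduct_eq]
  refine Finsupp.prod_congr fun H _ => ?_
  rw [← regTerm_fixedPairing_congr hG' hBι hB' (H := H)]
  · ext x
    simp [mem_fixedBy]
  · intro x y
    rw [Nat.card_congr (H.equivMapOfInjective ι hι).toEquiv]

/-- The preimage of `H` has order `|H| |ker π|`. The factors for the inflated module with `B` are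
therefore those for `ρ` with `|ker π|⁻¹ B`, which is as good a pairing as any. -/
theorem regulatorConstant_infRel {Z : Type*} [Group Z] [Finite Z] (hG : (Nat.card G : K) ≠ 0)
    (hZ : (Nat.card Z : K) ≠ 0) {π : Z →* G} (hπ : Function.Surjective π) {Θ : Subgroup G →₀ ℤ}
    (hΘ : IsBrauerRelation Θ) {ρ : Representation R G M}
    (h : ∃ B : M →ₗ[R] M →ₗ[R] K, IsInvariantPairing ρ B ∧ IsNondegeneratePairing B) :
    regulatorConstant K (infRel π Θ) (ρ.comp π) = regulatorConstant K Θ ρ := by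
  obtain ⟨B₀, h₀, h₀'⟩ := h
  obtain ⟨B, hB, hB', hreg⟩ := exists_regulatorConstant_eq (ρ := ρ.comp π)
    ⟨B₀, fun z => h₀ (π z), h₀'⟩
  have hk : (Nat.card π.ker : K)⁻¹ ≠ 0 := inv_ne_zero (card_subgroup_ne_zero hZ _)
  have hC : IsInvariantPairing ρ ((Nat.card π.ker : K)⁻¹ • B) := fun g x y => by
    obtain ⟨z, rfl⟩ := hπ g
    exact congrArg _ (hB z x y)
  have hC' : IsNondegeneratePairing ((Nat.card π.ker : K)⁻¹ • B) := by
    obtain ⟨n, ⟨c⟩⟩ := TorsionCoord.exists_fin (R := R) (F := M)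
    rw [isNondegeneratePairing_iff c] at hB' ⊢
    have : c.gram ((Nat.card π.ker : K)⁻¹ • B) = (Nat.card π.ker : K)⁻¹ • c.gram B := rfl
    rw [this, Matrix.det_smul]
    exact mul_ne_zero (pow_ne_zero _ hk) hB'
  rw [hreg, regulatorConstant_eq hG hΘ ρ hC hC', infRel, regulatorProduct_mapDomain,
    regulatorProduct_eq]
  refine Finsupp.prod_congr fun H _ => ?_
  rw [← regTerm_fixedPairing_congr hG hC hC' (H := H)]
  · ext x
    simp only [mem_fixedBy, Subgroup.mem_comap]
    exact ⟨fun hx z hz => hx _ hz, fun hx g hg => by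
      obtain ⟨z, rfl⟩ := hπ g
      exact hx z hg⟩
  · intro x y
    have : Nat.card (H.comap π) = Nat.card H * Nat.card π.ker := by
      apply Nat.eq_of_mul_eq_mul_right (Nat.pos_of_ne_zero H.index_ne_zero_of_finite)
      rw [← H.index_comap_of_surjective hπ, Subgroup.card_mul_index,
        H.index_comap_of_surjective hπ, mul_right_comm, Subgroup.card_mul_index,
        ← π.ker.card_mul_index, Subgroup.index_ker, mul_comm, MonoidHom.range_eq_top.mpr hπ,
        Subgroup.card_top]
    rw [this, Nat.cast_mul, mul_inv, mul_assoc]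
    rfl

theorem regulatorConstant_extendScalars {S E : Type*} [CommRing S] [IsDomain S]
    [IsPrincipalIdealRing S] [Algebra R S] [FaithfulSMul R S] [Field E] [Algebra S E]
    [FaithfulSMul S E] [Algebra K E] [Algebra R E] [IsScalarTower R K E] [IsScalarTower R S E]
    (hG : (Nat.card G : K) ≠ 0) {Θ : Subgroup G →₀ ℤ} (hΘ : IsBrauerRelation Θ)
    {ρ : Representation R G M}
    (h : ∃ B : M →ₗ[R] M →ₗ[R] K, IsInvariantPairing ρ B ∧ IsNondegeneratePairing B) :
    regulatorConstant E Θ (extendScalars S ρ) =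
      unitClassMap R K S E (regulatorConstant K Θ ρ) := by
  have : FaithfulSMul R E := FaithfulSMul.trans R S E
  obtain ⟨B, hB, hB'⟩ := h
  have hG' : (Nat.card G : E) ≠ 0 := by
    rw [← map_natCast (algebraMap K E)]
    exact (map_ne_zero _).mpr hG
  have hinv : IsInvariantPairing (extendScalars S ρ) (extendPairing S (mapPairing E B)) :=
    isInvariant_extendPairing (isInvariantPairing_mapPairing hB) S
  have hnd : IsNondegeneratePairing (extendPairing S (mapPairing E B)) := by
    obtain ⟨n, ⟨c⟩⟩ := TorsionCoord.exists_fin (R := R) (F := M)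
    rw [isNondegeneratePairing_iff (c.baseChange S), gram_extendPairing,
      ← isNondegeneratePairing_iff c]
    exact isNondegeneratePairing_mapPairing hB'
  rw [regulatorConstant_eq hG' hΘ _ hinv hnd, regulatorConstant_eq hG hΘ ρ hB hB',
    regulatorProduct_eq, regulatorProduct_eq, map_finsuppProd]
  refine Finsupp.prod_congr fun H _ => ?_
  obtain ⟨n, ⟨c⟩⟩ := TorsionCoord.exists_fin (R := R) (F := fixedBy ρ H)
  have hne := det_gram_fixedPairing_ne_zero ρ c hG hB hB'
  rw [map_zpow, ← unitClassMap_regTerm c S E _ hne]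
  congr 1
  refine (regTerm_congr (c.baseChange S) (fixedBaseChange ρ S H) _ _ (fun x y => ?_) ?_).symm
  · rw [fixedPairing_apply]
    induction x with
    | zero => simp
    | add x x' hx hx' =>
      simp only [map_add, LinearMap.add_apply, Submodule.coe_add, mul_add, hx, hx']
    | tmul s m =>
      induction y with
      | zero => simp
      | add y y' hy hy' => simp only [map_add, Submodule.coe_add, mul_add, hy, hy']
      | tmul t n =>
        rw [coe_fixedBaseChange_tmul, coe_fixedBaseChange_tmul]
        simp [fixedPairing_apply]
        ring
  · rw [gram_extendPairing, gram_mapPairing, ← RingHom.mapMatrix_apply, ← RingHom.map_det]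
    exact (map_ne_zero _).mpr hne

end Functoriality

/-! ### Coinduced representations and double cosets -/

section Mackey

variable {G : Type*} [Group G] (Y H : Subgroup G)

/-- The subgroup `Y ∩ g⁻¹Hg` of `Y`. -/
def conjInter (g : G) : Subgroup Y :=
  (H.map (MulAut.conj g⁻¹).toMonoidHom).subgroupOf Y

variable {Y H}

theorem mem_conjInter {g : G} {t : Y} : t ∈ conjInter Y H g ↔ g * t * g⁻¹ ∈ H := by
  rw [conjInter, Subgroup.mem_subgroupOf, Subgroup.mem_map]
  constructor
  · rintro ⟨h, hh, e⟩
    rw [← e]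
    simpa [mul_assoc] using hh
  · intro h
    exact ⟨_, h, by simp [mul_assoc]⟩

variable {r : DoubleCoset.Quotient (H : Set G) (Y : Set G) → G}

/-- Coinduced functions are equivariant under `Y` on the left and `H` acts on the right, whereas the
relation uses `H\G/Y`; inversion passes from one to the other. -/
theorem exists_doubleCoset_decomp (hr : ∀ q, DoubleCoset.mk H Y (r q) = q) (x : G) :
    ∃ (a : Y) (h : H), x = a * (r (DoubleCoset.mk H Y x⁻¹))⁻¹ * h := by
  obtain ⟨h, hh, y, hy, e⟩ := (DoubleCoset.eq H Y _ _).mp (hr (DoubleCoset.mk H Y x⁻¹))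
  refine ⟨⟨y⁻¹, Y.inv_mem hy⟩, ⟨h⁻¹, H.inv_mem hh⟩, ?_⟩
  generalize r (DoubleCoset.mk H Y x⁻¹) = g at e
  rw [← inv_inv x, e]
  simp [mul_assoc]

theorem mk_inv_decomp (hr : ∀ q, DoubleCoset.mk H Y (r q) = q) (a : Y) (h : H)
    (q : DoubleCoset.Quotient (H : Set G) (Y : Set G)) :
    DoubleCoset.mk H Y (a * (r q)⁻¹ * h : G)⁻¹ = q := by
  refine Eq.trans ?_ (hr q)
  refine ((DoubleCoset.eq H Y _ _).mpr ⟨h⁻¹, H.inv_mem h.2, a⁻¹, Y.inv_mem a.2, ?_⟩).symm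
  simp [mul_assoc]

/-- Orbit–stabilizer for `Y × H` acting on `Y g⁻¹ H`: the pairs `(y, k)` with a given product `y g⁻¹
k` are permuted simply transitively by `Y ∩ g⁻¹Hg`. -/
theorem card_fiber_mul_card [Finite G] (hr : ∀ q, DoubleCoset.mk H Y (r q) = q)
    (q : DoubleCoset.Quotient (H : Set G) (Y : Set G)) :
    Nat.card {x : G // DoubleCoset.mk H Y x⁻¹ = q} * Nat.card (conjInter Y H (r q)) =
      Nat.card Y * Nat.card H := by
  rw [← Nat.card_prod, ← Nat.card_prod]
  choose a h hx using exists_doubleCoset_decomp hr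
  have hx' : ∀ x : {x : G // DoubleCoset.mk H Y x⁻¹ = q}, (x : G) = a x * (r q)⁻¹ * h x :=
    fun x => by
      have := hx x
      rwa [x.2] at this
  let φ : {x : G // DoubleCoset.mk H Y x⁻¹ = q} × conjInter Y H (r q) → Y × H := fun p =>
    (a p.1 * p.2, (⟨_, mem_conjInter.mp p.2.2⟩ : H)⁻¹ * h p.1)
  have hφ : ∀ p, ((φ p).1 : G) * (r q)⁻¹ * (φ p).2 = p.1 := fun p => by
    rw [hx' p.1]
    simp [φ, mul_assoc]
  refine Nat.card_congr (Equiv.ofBijective φ ⟨fun p p' e => ?_, fun ⟨y, k⟩ => ?_⟩)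
  · have h₁ : p.1 = p'.1 := Subtype.ext (by rw [← hφ p, ← hφ p', e])
    have h₂ : a p.1 * p.2 = a p'.1 * p'.2 := congrArg Prod.fst e
    rw [h₁] at h₂
    exact Prod.ext h₁ (Subtype.ext (mul_left_cancel h₂))
  · let x : {x : G // DoubleCoset.mk H Y x⁻¹ = q} :=
      ⟨y * (r q)⁻¹ * k, mk_inv_decomp hr y k q⟩
    have e : (y * (r q)⁻¹ * k : G) = a x * (r q)⁻¹ * h x := hx' x
    have e' : r q * ((a x)⁻¹ * y : Y) * (r q)⁻¹ = (h x * k⁻¹ : H) := by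
      have : (y * (r q)⁻¹ : G) = a x * (r q)⁻¹ * h x * (k : G)⁻¹ := by
        rw [← e]; group
      rw [Subgroup.coe_mul, mul_assoc, mul_assoc, this]
      simp [mul_assoc]
    have ht : (a x)⁻¹ * y ∈ conjInter Y H (r q) := by
      rw [mem_conjInter, e']
      exact SetLike.coe_mem _
    refine ⟨(x, ⟨_, ht⟩), Prod.ext (mul_inv_cancel_left _ _) (Subtype.ext ?_)⟩
    simp only [φ, Subgroup.coe_mul, Subgroup.coe_inv] at e' ⊢
    rw [e']
    group

variable {R N : Type*} [CommRing R] [AddCommGroup N] [Module R N] (ρ : Representation R Y N)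

theorem coind_apply_mul (f : Representation.coindV Y.subtype ρ) (y : Y) (x : G) :
    f.1 (y * x) = ρ y (f.1 x) := f.2 y x

theorem apply_mul_of_mem_fixedBy_coind {f : Representation.coindV Y.subtype ρ}
    (hf : f ∈ fixedBy (Representation.coind Y.subtype ρ) H) (h : H) (x : G) :
    f.1 (x * h) = f.1 x :=
  congrFun (congrArg Subtype.val (mem_fixedBy.mp hf h h.2)) x

/-- Values at inverses of double coset representatives. -/
def coindEval (r : DoubleCoset.Quotient (H : Set G) (Y : Set G) → G) :
    fixedBy (Representation.coind Y.subtype ρ) H →ₗ[R]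
      ∀ q, fixedBy ρ (conjInter Y H (r q)) where
  toFun f q := ⟨f.1.1 (r q)⁻¹, mem_fixedBy.mpr fun t ht => by
    rw [← coind_apply_mul, ← apply_mul_of_mem_fixedBy_coind ρ f.2 ⟨_, mem_conjInter.mp ht⟩
      (r q)⁻¹]
    simp [mul_assoc]⟩
  map_add' _ _ := rfl
  map_smul' _ _ := rfl

/-- Mackey's decomposition of the fixed space: equivariance on both sides propagates the value at
`(r q)⁻¹` over its double coset, and the only constraint on that value is invariance under the
stabilizer. -/
theorem coindEval_bijective (hr : ∀ q, DoubleCoset.mk H Y (r q) = q) :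
    Function.Bijective (coindEval ρ r) := by
  constructor
  · intro f f' e
    ext x
    obtain ⟨a, h, hx⟩ := exists_doubleCoset_decomp hr x
    have : f.1.1 (r (DoubleCoset.mk H Y x⁻¹))⁻¹ = f'.1.1 (r (DoubleCoset.mk H Y x⁻¹))⁻¹ :=
      congrArg Subtype.val (congrFun e _)
    rw [hx, apply_mul_of_mem_fixedBy_coind ρ f.2, apply_mul_of_mem_fixedBy_coind ρ f'.2,
      coind_apply_mul, coind_apply_mul, this]
  · intro v
    choose a h hx using exists_doubleCoset_decomp hr
    let f : G → N := fun x => ρ (a x) (v (DoubleCoset.mk H Y x⁻¹))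
    -- Two decompositions of one element differ by an element of `conjInter`, which fixes `v q`; so
    -- the choice of `a` is immaterial.
    have hf : ∀ (y : Y) (k : H) q, f (y * (r q)⁻¹ * k) = ρ y (v q) := by
      intro y k q
      have hq := mk_inv_decomp hr y k q
      have e := hx (y * (r q)⁻¹ * k)
      simp only [f]
      generalize a (y * (r q)⁻¹ * k) = b at *
      generalize h (y * (r q)⁻¹ * k) = l at *
      rw [hq] at e ⊢
      have ht : b⁻¹ * y ∈ conjInter Y H (r q) := by
        rw [mem_conjInter]
        have : r q * ((b⁻¹ * y : Y) : G) * (r q)⁻¹ = (l * k⁻¹ : H) := by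
          have : (y * (r q)⁻¹ : G) = b * (r q)⁻¹ * l * (k : G)⁻¹ := by
            rw [← e]; group
          rw [Subgroup.coe_mul, mul_assoc, mul_assoc, this]
          simp [mul_assoc]
        rw [this]
        exact SetLike.coe_mem _
      rw [← mem_fixedBy.mp (v q).2 _ ht, ← Module.End.mul_apply, ← map_mul, mul_inv_cancel_left,
        mem_fixedBy.mp (v q).2 _ ht]
    have hmem : f ∈ Representation.coindV Y.subtype ρ := fun y x => by
      obtain ⟨b, k, e⟩ := exists_doubleCoset_decomp hr x
      rw [e, hf, ← Module.End.mul_apply, ← map_mul, ← hf (y * b) k]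
      congr 1
      simp [mul_assoc]
    refine ⟨⟨⟨f, hmem⟩, mem_fixedBy.mpr fun g hg => ?_⟩, ?_⟩
    · ext x
      change f (x * g) = f x
      obtain ⟨b, k, e⟩ := exists_doubleCoset_decomp hr x
      rw [e, hf, ← hf b (k * ⟨g, hg⟩)]
      congr 1
      simp [mul_assoc]
    · ext q
      change f (r q)⁻¹ = v q
      have := hf 1 1 q
      simpa using this

end Mackey

/-! ### Pairings on induced representations -/

section Induction

/-- Allows the constant of the induced module to be computed on the coinduced one. -/
theorem regulatorConstant_congr {R K : Type*} [CommRing R] [IsDomain R] [IsPrincipalIdealRing R]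
    [Field K] [Algebra R K] [FaithfulSMul R K] {G : Type*} [Group G] [Finite G]
    {M N : Type*} [AddCommGroup M] [Module R M] [Module.Finite R M] [AddCommGroup N] [Module R N]
    [Module.Finite R N] (hG : (Nat.card G : K) ≠ 0) {Θ : Subgroup G →₀ ℤ}
    (hΘ : IsBrauerRelation Θ) {ρ : Representation R G M} {σ : Representation R G N}
    (e : M ≃ₗ[R] N) (he : ∀ g x, e (ρ g x) = σ g (e x)) {B : N →ₗ[R] N →ₗ[R] K}
    (hB : IsInvariantPairing σ B) (hB' : IsNondegeneratePairing B) :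
    regulatorConstant K Θ ρ = regulatorProduct Θ σ B := by
  have hC : IsInvariantPairing ρ (B.compl₁₂ e.toLinearMap e.toLinearMap) := fun g x y => by
    simp [he, hB g]
  have hC' : IsNondegeneratePairing (B.compl₁₂ e.toLinearMap e.toLinearMap) := by
    obtain ⟨n, ⟨c⟩⟩ := TorsionCoord.exists_fin (R := R) (F := M)
    rw [isNondegeneratePairing_iff (c.map e)] at hB'
    rw [isNondegeneratePairing_iff c]
    exact hB'
  rw [regulatorConstant_eq hG hΘ ρ hC hC', regulatorProduct_eq, regulatorProduct_eq]
  refine Finsupp.prod_congr fun H _ => ?_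
  obtain ⟨n, ⟨c⟩⟩ := TorsionCoord.exists_fin (R := R) (F := fixedBy ρ H)
  let e' : fixedBy ρ H ≃ₗ[R] fixedBy σ H := invariantsCongr e fun h x => he h x
  rw [regTerm_congr c e' _ (fixedPairing σ H B) (fun x y => rfl)
    (det_gram_fixedPairing_ne_zero ρ c hG hC hC')]

variable {R K : Type*} [CommRing R] [Field K] [Algebra R K]
  {G : Type*} [Group G] [Fintype G] {Y : Subgroup G}
  {N : Type*} [AddCommGroup N] [Module R N] (ρ : Representation R Y N)

/-- The pairing `|Y|⁻¹ ∑ₓ B (f x) (f' x)` on a coinduced representation. -/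
def coindPairing (B : N →ₗ[R] N →ₗ[R] K) :
    Representation.coindV Y.subtype ρ →ₗ[R] Representation.coindV Y.subtype ρ →ₗ[R] K :=
  (Nat.card Y : K)⁻¹ • ∑ x : G,
    B.compl₁₂ (LinearMap.proj x ∘ₗ (Representation.coindV Y.subtype ρ).subtype)
      (LinearMap.proj x ∘ₗ (Representation.coindV Y.subtype ρ).subtype)

theorem coindPairing_apply (B : N →ₗ[R] N →ₗ[R] K) (f f' : Representation.coindV Y.subtype ρ) :
    coindPairing ρ B f f' = (Nat.card Y : K)⁻¹ * ∑ x : G, B (f.1 x) (f'.1 x) := by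
  simp [coindPairing, LinearMap.sum_apply]

theorem isInvariantPairing_coindPairing (B : N →ₗ[R] N →ₗ[R] K) :
    IsInvariantPairing (Representation.coind Y.subtype ρ) (coindPairing ρ B) := fun g f f' => by
  rw [coindPairing_apply, coindPairing_apply]
  congr 1
  exact Fintype.sum_equiv (Equiv.mulRight g) _ (fun x => B (f.1 x) (f'.1 x)) fun x => rfl

variable [IsDomain R] [IsPrincipalIdealRing R] [FaithfulSMul R K]

/-- The summand is constant on each `Y g⁻¹ H`, a set of `|Y| |H| / |Y ∩ g⁻¹Hg|` elements. The
normalizations `|Y|⁻¹` and `|H|⁻¹` thus leave exactly the factor `|Y ∩ g⁻¹Hg|⁻¹` required on the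
right. -/
theorem fixedPairing_coindPairing (hG : (Nat.card G : K) ≠ 0) {B : N →ₗ[R] N →ₗ[R] K}
    (hB : IsInvariantPairing ρ B) {H : Subgroup G}
    [Fintype (DoubleCoset.Quotient (H : Set G) (Y : Set G))]
    {r : DoubleCoset.Quotient (H : Set G) (Y : Set G) → G}
    (hr : ∀ q, DoubleCoset.mk H Y (r q) = q)
    (f f' : fixedBy (Representation.coind Y.subtype ρ) H) :
    fixedPairing (Representation.coind Y.subtype ρ) H (coindPairing ρ B) f f' =
      ∑ q, fixedPairing ρ (conjInter Y H (r q)) B (coindEval ρ r f q) (coindEval ρ r f' q) := by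
  classical
  rw [fixedPairing_apply, coindPairing_apply,
    ← Fintype.sum_fiberwise (fun x : G => DoubleCoset.mk H Y x⁻¹), Finset.mul_sum, Finset.mul_sum]
  refine Finset.sum_congr rfl fun q _ => ?_
  have h : ∀ x : {x : G // DoubleCoset.mk H Y x⁻¹ = q}, B (f.1.1 x) (f'.1.1 x) =
      B (f.1.1 (r q)⁻¹) (f'.1.1 (r q)⁻¹) := fun x => by
    obtain ⟨a, h, e⟩ := exists_doubleCoset_decomp hr (x : G)
    rw [x.2] at e
    rw [e, apply_mul_of_mem_fixedBy_coind ρ f.2, apply_mul_of_mem_fixedBy_coind ρ f'.2,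
      coind_apply_mul, coind_apply_mul, hB]
  rw [Finset.sum_congr rfl fun x _ => h x, Finset.sum_const, Finset.card_univ, nsmul_eq_mul,
    ← Nat.card_eq_fintype_card, fixedPairing_apply]
  have hc := congrArg (Nat.cast : ℕ → K) (card_fiber_mul_card hr q)
  have hY := card_subgroup_ne_zero hG Y
  have hH := card_subgroup_ne_zero hG H
  have hq := card_subgroup_ne_zero hY (conjInter Y H (r q))
  push_cast at hc
  rw [← mul_assoc, ← mul_assoc]
  congr 1
  field_simp
  rw [hc]
  ring

variable [Module.Finite R N]

theorem regTerm_coindPairing (hG : (Nat.card G : K) ≠ 0) {B : N →ₗ[R] N →ₗ[R] K}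
    (hB : IsInvariantPairing ρ B) (hB' : IsNondegeneratePairing B) {H : Subgroup G}
    [Fintype (DoubleCoset.Quotient (H : Set G) (Y : Set G))]
    {r : DoubleCoset.Quotient (H : Set G) (Y : Set G) → G}
    (hr : ∀ q, DoubleCoset.mk H Y (r q) = q) :
    IsNondegeneratePairing (M := fixedBy (Representation.coind Y.subtype ρ) H)
        (fixedPairing (Representation.coind Y.subtype ρ) H (coindPairing ρ B)) ∧
      regTerm (F := fixedBy (Representation.coind Y.subtype ρ) H)
          (fixedPairing (Representation.coind Y.subtype ρ) H (coindPairing ρ B)) =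
        ∏ q, regTerm (fixedPairing ρ (conjInter Y H (r q)) B) := by
  classical
  choose n c using fun q =>
    TorsionCoord.exists_fin (R := R) (F := fixedBy ρ (conjInter Y H (r q)))
  let C := TorsionCoord.pi fun q => (c q).some
  obtain ⟨hne, hprod⟩ := regTerm_pi (fun q => (c q).some)
    (fun q => fixedPairing ρ (conjInter Y H (r q)) B) fun q =>
      det_gram_fixedPairing_ne_zero ρ (c q).some (card_subgroup_ne_zero hG Y) hB hB'
  let E := LinearEquiv.ofBijective (coindEval ρ r) (coindEval_bijective ρ hr)
  have hE : ∀ x y, fixedPairing (Representation.coind Y.subtype ρ) H (coindPairing ρ B)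
      (E.symm x) (E.symm y) =
        piPairing (fun q => fixedPairing ρ (conjInter Y H (r q)) B) x y := fun x y => by
    have h : ∀ x, coindEval ρ r (E.symm x) = x := E.apply_symm_apply
    rw [fixedPairing_coindPairing ρ hG hB hr, piPairing_apply, h, h]
  constructor
  · let C' := TorsionCoord.map (F' := fixedBy (Representation.coind Y.subtype ρ) H) C E.symm
    rw [isNondegeneratePairing_iff C']
    have : C'.gram (fixedPairing (Representation.coind Y.subtype ρ) H
        (coindPairing ρ B)) =
          C.gram (piPairing fun q => fixedPairing ρ (conjInter Y H (r q)) B) := by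
      ext i j
      exact hE _ _
    rwa [this]
  · rw [← hprod]
    exact (regTerm_congr C E.symm _ _ hE hne).symm

/-- This is the decomposition for `H = ⊥`, where everything is fixed and `|H|⁻¹ = 1`. -/
theorem isNondegeneratePairing_coindPairing (hG : (Nat.card G : K) ≠ 0) {B : N →ₗ[R] N →ₗ[R] K}
    (hB : IsInvariantPairing ρ B) (hB' : IsNondegeneratePairing B) :
    IsNondegeneratePairing (coindPairing ρ B) := by
  have := Finite.of_surjective (DoubleCoset.mk ⊥ Y) Quotient.mk_surjective
  have := Fintype.ofFinite (DoubleCoset.Quotient ((⊥ : Subgroup G) : Set G) (Y : Set G))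
  have h := (regTerm_coindPairing ρ hG hB hB' (H := ⊥)
    (Function.surjInv_eq (f := DoubleCoset.mk ⊥ Y) Quotient.mk_surjective)).1
  obtain ⟨n, ⟨c⟩⟩ := TorsionCoord.exists_fin (R := R)
    (F := fixedBy (Representation.coind Y.subtype ρ) ⊥)
  have htop : fixedBy (Representation.coind Y.subtype ρ) ⊥ = ⊤ := by
    refine Submodule.eq_top_iff'.mpr fun x => mem_fixedBy.mpr fun g hg => ?_
    rw [Subgroup.mem_bot.mp hg, map_one, Module.End.one_apply]
  rw [isNondegeneratePairing_iff c] at h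
  rw [isNondegeneratePairing_iff (c.map (LinearEquiv.ofTop _ htop))]
  have : (c.map (LinearEquiv.ofTop _ htop)).gram (coindPairing ρ B) =
      c.gram (fixedPairing (Representation.coind Y.subtype ρ) ⊥ (coindPairing ρ B)) := by
    ext i j
    refine Eq.trans ?_ (fixedPairing_apply _ _ _ _ _).symm
    rw [Subgroup.card_bot, Nat.cast_one, inv_one, one_mul]
    rfl
  rwa [this]

end Induction

/-! ### Induced versus coinduced modules, and the restriction formula -/

section Induction

variable {R : Type*} [CommRing R] {G : Type*} [Group G] [Finite G] {Y : Subgroup G}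
  {N : Type*} [AddCommGroup N] [Module R N] (ρ : Representation R Y N)

/-- Induced and coinduced representations of a finite group are isomorphic. -/
theorem exists_indV_equiv_coindV :
    ∃ e : Representation.IndV Y.subtype ρ ≃ₗ[R] Representation.coindV Y.subtype ρ,
      ∀ g x, e (Representation.ind Y.subtype ρ g x) =
        Representation.coind Y.subtype ρ g (e x) := by
  classical
  have h₁ := Rep.coindToInd_indToCoind (Rep.of ρ)
  have h₂ := Rep.indToCoind_coindToInd (Rep.of ρ)
  refine ⟨LinearEquiv.ofLinearMap (Rep.indToCoind (Rep.of ρ)) (Rep.coindToInd (Rep.of ρ)) h₁ h₂, ?_⟩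
  intro g x
  have : Rep.indToCoind (Rep.of ρ) ∘ₗ Representation.ind Y.subtype ρ g =
      Representation.coind Y.subtype ρ g ∘ₗ Rep.indToCoind (Rep.of ρ) := by
    ext g₁ a g₂
    simp
    exact Rep.indToCoindAux_fst_mul_inv (A := Rep.of ρ) g₁ g g₂ a
  exact LinearMap.congr_fun this x

variable {K : Type*} [IsDomain R] [IsPrincipalIdealRing R] [Field K] [Algebra R K]
  [FaithfulSMul R K] [Module.Finite R N]

/-- The factor at `H` of the coinduced module splits over `H\G/Y` into the factors of `N` at `Y ∩
g⁻¹Hg`, which are the terms that `H` contributes to the restricted relation. -/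
theorem regulatorConstant_resRel (hG : (Nat.card G : K) ≠ 0) {Θ : Subgroup G →₀ ℤ}
    (hΘ : IsBrauerRelation Θ)
    {r : ∀ H : Subgroup G, DoubleCoset.Quotient (H : Set G) (Y : Set G) → G}
    (hr : ∀ H q, DoubleCoset.mk H Y (r H q) = q)
    (h : ∃ B : N →ₗ[R] N →ₗ[R] K, IsInvariantPairing ρ B ∧ IsNondegeneratePairing B) :
    regulatorConstant K (resRel Y r Θ) ρ =
      regulatorConstant K Θ (Representation.ind Y.subtype ρ) := by
  have := Fintype.ofFinite G
  have := fun H : Subgroup G => Finite.of_surjective (DoubleCoset.mk H Y) Quotient.mk_surjective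
  have := fun H : Subgroup G =>
    Fintype.ofFinite (DoubleCoset.Quotient (H : Set G) (Y : Set G))
  obtain ⟨B, hB, hB', hreg⟩ := exists_regulatorConstant_eq h
  obtain ⟨e, he⟩ := exists_indV_equiv_coindV ρ
  have := Module.Finite.equiv e.symm
  rw [hreg, regulatorConstant_congr hG hΘ e he (isInvariantPairing_coindPairing ρ B)
    (isNondegeneratePairing_coindPairing ρ hG hB hB'), regulatorProduct_eq, regulatorProduct_eq,
    resRel, Finsupp.prod_sum_index (fun _ => zpow_zero _) (fun _ _ _ => zpow_add _ _ _)]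
  refine Finsupp.prod_congr fun H _ => ?_
  rw [(regTerm_coindPairing ρ hG hB hB' (hr H)).2, finsum_eq_sum_of_fintype]
  refine (Finsupp.prod_finsetSum_index (h := fun H' n => regTerm (fixedPairing ρ H' B) ^ n)
    (fun _ => zpow_zero _) (fun _ _ _ => zpow_add _ _ _)).symm.trans ?_
  refine Eq.trans ?_ (Finset.prod_zpow (G := UnitClass R K) _ _ _)
  exact Finset.prod_congr rfl fun q _ => Finsupp.prod_single_index (zpow_zero _)

end Induction

end RegConst

end

theorem mainTheorem8
    {R K L : Type*} [CommRing R] [IsDomain R] [IsPrincipalIdealRing R]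
    [Field K] [Algebra R K] [IsFractionRing R K]
    [Field L] [Algebra K L] [Algebra R L] [IsScalarTower R K L] [FaithfulSMul R L]
    {G : Type*} [Group G] [Finite G] (hG : (Nat.card G : K) ≠ 0)
    (Θ : Subgroup G →₀ ℤ) (hΘ : IsBrauerRelation Θ) :
    -- independence of the pairing and of the field in which it takes its values
    (∀ (M : Type*) [AddCommGroup M] [Module R M] [Module.Finite R M] (ρ : Representation R G M)
      (B : M →ₗ[R] M →ₗ[R] L), IsInvariantPairing ρ B → IsNondegeneratePairing B →
      unitClassMap R K R L (regulatorConstant K Θ ρ) = regulatorProduct Θ ρ B) ∧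
    -- (i) induction of relations and restriction of modules
    (∀ (X : Type*) [Group X] [Finite X] (ι : G →* X), Function.Injective ι →
      (Nat.card X : K) ≠ 0 →
      ∀ (N : Type*) [AddCommGroup N] [Module R N] [Module.Finite R N] (ρ : Representation R X N),
      IsSelfDual R L ρ →
      regulatorConstant K (indRel ι Θ) ρ = regulatorConstant K Θ (ρ.comp ι)) ∧
    -- (ii) restriction of relations and induction of modules
    (∀ (Y : Subgroup G)
      (r : ∀ H : Subgroup G, DoubleCoset.Quotient (H : Set G) (Y : Set G) → G),
      (∀ (H : Subgroup G) (q : DoubleCoset.Quotient (H : Set G) (Y : Set G)),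
        DoubleCoset.mk H Y (r H q) = q) →
      ∀ (N : Type*) [AddCommGroup N] [Module R N] [Module.Finite R N] (ρ : Representation R Y N),
      IsSelfDual R L ρ →
      regulatorConstant K (resRel Y r Θ) ρ =
        regulatorConstant K Θ (Representation.ind Y.subtype ρ)) ∧
    -- (iii) inflation
    (∀ (Z : Type*) [Group Z] [Finite Z] (π : Z →* G), Function.Surjective π →
      (Nat.card Z : K) ≠ 0 →
      ∀ (M : Type*) [AddCommGroup M] [Module R M] [Module.Finite R M] (ρ : Representation R G M),
      IsSelfDual R L ρ →
      regulatorConstant K (infRel π Θ) (ρ.comp π) = regulatorConstant K Θ ρ) ∧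
    -- (iv) extension of scalars
    (∀ (S E : Type*) [CommRing S] [IsDomain S] [IsPrincipalIdealRing S]
      [Algebra R S] [FaithfulSMul R S] [Field E] [Algebra S E] [IsFractionRing S E]
      [Algebra K E] [Algebra R E] [IsScalarTower R K E] [IsScalarTower R S E],
      ∀ (M : Type*) [AddCommGroup M] [Module R M] [Module.Finite R M] (ρ : Representation R G M),
      IsSelfDual R L ρ →
      regulatorConstant E Θ (extendScalars S ρ) =
        unitClassMap R K S E (regulatorConstant K Θ ρ)) := by
  have : FaithfulSMul R K :=
    (faithfulSMul_iff_algebraMap_injective R K).mpr (IsFractionRing.injective R K)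
  refine ⟨?_, ?_, ?_, ?_, ?_⟩
  · intro M _ _ _ ρ B hB hB'
    exact unitClassMap_regulatorConstant hG hΘ ρ hB hB'
  · intro X _ _ ι hι hX N _ _ _ ρ hρ
    -- Self-duality is given over `L`; as `|X| ≠ 0` in `K`, it descends to a `K`-valued pairing.
    exact regulatorConstant_indRel hX hι hΘ (exists_pairing_of_isSelfDual K hX hρ)
  · intro Y r hr N _ _ _ ρ hρ
    exact regulatorConstant_resRel ρ hG hΘ hr
      (exists_pairing_of_isSelfDual K (card_subgroup_ne_zero hG Y) hρ)
  · intro Z _ _ π hπ hZ M _ _ _ ρ hρ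
    exact regulatorConstant_infRel hG hZ hπ hΘ (exists_pairing_of_isSelfDual K hG hρ)
  · intro S E _ _ _ _ _ _ _ _ _ _ _ _ M _ _ _ ρ hρ
    have : FaithfulSMul S E :=
      (faithfulSMul_iff_algebraMap_injective S E).mpr (IsFractionRing.injective S E)
    exact regulatorConstant_extendScalars hG hΘ (exists_pairing_of_isSelfDual K hG hρ)
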